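/- Let $\mathbb{K}$ be a field of characteristic zero, and let $n=k+1$. For a partition $\nu$ with Young diagram $D_\nu=\{(i,j):1\le j\le \nu_i\}$, a Young tableau of shape $\nu$ is a bijection $T$ from $D_\nu$ to a finite set of entries. If the entries lie in $\{1,\dots,n\}$, its Young symmetrizer is $$\mathfrak{c}_\nu(T)=\Big(\sum_{\sigma\in\mathcal{R}_T}\sigma\Big)\cdot\Big(\sum_{\tau\in\mathcal{C}_T}\operatorname{sgn}(\tau)\,\tau\Big)\in\mathbb{K}[\mathfrak{S}_n],$$ where $\mathcal{R}_T$ (resp. $\mathcal{C}_T$) is the group of permutations of $\{1,\dots,n\}$ that fix every element which is not an entry of $T$ and map each row (resp. each column) of $T$ onto itself; permutations are composed from right to left. The hook of $\nu$ centered at $(x,y)\in D_\nu$ is $\{(x,j)\in D_\nu:j\ge y\}\cup\{(i,y)\in D_\nu:i\ge x\}$, its length is its number of elements, and $\alpha_\nu$ is the product of the lengths of all hooks of $\nu$. The blocks of a tableau are obtained by grouping together its columns of the same height; they are listed from left to right, and the length (resp. height) of a block is its number of columns (resp. rows). Let $\lambda\vdash n$ and $\mu\vdash k$ be partitions with $\mu\subset\lambda$,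 let $T$ be a Young tableau of shape $\lambda$ with entries $1,\dots,n$, and let $S$ be the subtableau of shape $\mu$ (the restriction of $T$ to $D_\mu$). Let $a$ be the unique entry of $T$ outside $S$, located in position $(u,v)$, i.e. $\lambda_i=\mu_i$ for $i\ne u$ and $\lambda_u=v=\mu_u+1$. Let $\tilde S$ be the Young tableau obtained by removing from $S$ its first $v$ columns: its shape $\tilde\mu$ has $\tilde\mu_i=\mu_i-v$ for $i<u$ and $\tilde\mu_i=0$ otherwise. Write $\tilde B_1,\dots,\tilde B_{\tilde m}$ for the blocks of $\tilde S$, and $\tilde l_i$ (resp. $\tilde h_i$) for the length (resp. height) of $\tilde B_i$. For $i=1,\dots,\tilde m$ let $\tilde r_i$ be the length of the hook of $\mu$ centered at $(\tilde h_i,v)$; then $$\tilde r_i=\tilde l_1+\cdots+\tilde l_i+u-\tilde h_i .$$ Put $\tilde x_i=\sum_{b\in\tilde B_i}(a,b)\in\mathbb{K}[\mathfrak{S}_n]$, where $(a,b)$ is the transposition of $a$ and $b$. Then $$\mathfrak{c}_\lambda(T)\cdot\mathfrak{c}_\mu(S)=\mathfrak{c}_\lambda(T)\cdot\alpha_\mu\cdot\prod_{i=1}^{\tilde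 m}\Big(1-\frac{\tilde x_i}{\tilde r_i}\Big),$$ where the factors of the product are multiplied in the order $i=1,\dots,\tilde m$ from left to right. -/

import Mathlib

/-! Young diagrams are Mathlib's: finite lower sets of cells `(i, j)`, row index `i` and column
index `j`, both starting at `0`. So the cell `(i, j)` is the box in position `(i + 1, j + 1)` in the
usual 1-based convention; `ν.rowLen i` and `ν.colLen j` are the lengths of rows and columns. -/

namespace YoungDiagram

/-- The hook of `ν` centered at `c`: the cells of `ν` in the row of `c`, weakly to the right of `c`,
and those in the column of `c`, weakly below `c`. -/
def hook (ν : YoungDiagram) (c : ℕ × ℕ) : Finset (ℕ × ℕ) :=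
  ν.cells.filter fun d => (d.1 = c.1 ∧ c.2 ≤ d.2) ∨ (d.2 = c.2 ∧ c.1 ≤ d.1)

/-- The length (number of cells) of a hook. -/
def hookLength (ν : YoungDiagram) (c : ℕ × ℕ) : ℕ :=
  (ν.hook c).card

/-- The product of all the hook lengths of `ν`. -/
def hookProduct (ν : YoungDiagram) : ℕ :=
  ∏ c ∈ ν.cells, ν.hookLength c

/-- The Young diagram obtained from `ν` by removing its first `w` columns
(and moving the rest `w` steps to the left). -/
def dropColumns (ν : YoungDiagram) (w : ℕ) : YoungDiagram where
  cells := (ν.cells.filter fun c => w ≤ c.2).image fun c => (c.1, c.2 - w)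
  isLowerSet := by
    rintro ⟨i, j⟩ ⟨i', j'⟩ hle hmem
    obtain ⟨hi, hj⟩ : i' ≤ i ∧ j' ≤ j := hle
    simp only [Finset.coe_image, Finset.coe_filter, Set.mem_image, Set.mem_ofPred_eq,
      mem_cells, Prod.mk.injEq] at hmem ⊢
    obtain ⟨⟨p, q⟩, ⟨hpq, hw⟩, h1, h2⟩ := hmem
    simp only at hw h1 h2
    exact ⟨(i', j' + w), ⟨ν.up_left_mem (by omega) (by omega) hpq, by simp⟩, rfl, by simp⟩

theorem mem_of_mem_dropColumns {ν : YoungDiagram} {w : ℕ} {c : ℕ × ℕ}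
    (hc : c ∈ (ν.dropColumns w).cells) : (c.1, c.2 + w) ∈ ν.cells := by
  simp only [dropColumns, Finset.mem_image, Finset.mem_filter] at hc
  obtain ⟨⟨p, q⟩, ⟨hpq, hw⟩, rfl⟩ := hc
  simp only at hw
  simpa [Nat.sub_add_cancel hw] using hpq

/-- The set of heights of the (nonempty) columns of `ν`. -/
def columnHeights (ν : YoungDiagram) : Finset ℕ :=
  (Finset.range (ν.rowLen 0)).image ν.colLen

/-- The number of blocks of `ν`; a block is the rectangle formed by all columns of one height. -/
def numBlocks (ν : YoungDiagram) : ℕ :=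
  ν.columnHeights.card

/-- The height of the `i`-th block from the left: the heights of the columns of `ν`, listed without
repetition in decreasing order. -/
def blockHeight (ν : YoungDiagram) (i : Fin ν.numBlocks) : ℕ :=
  ν.columnHeights.orderEmbOfFin rfl (Fin.rev i)

/-- The length of the `i`-th block from the left: its number of columns. -/
def blockLength (ν : YoungDiagram) (i : Fin ν.numBlocks) : ℕ :=
  ((Finset.range (ν.rowLen 0)).filter fun j => ν.colLen j = ν.blockHeight i).card

end YoungDiagram

/-- A Young tableau of shape `ν` with entries in `A`: a filling of the cells of `ν` by distinct
elements of `A`. It is a bijection from the cells of `ν` onto its set of entries, which may be a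
proper subset of `A`. -/
abbrev YoungTableau (ν : YoungDiagram) (A : Type*) : Type _ :=
  {c : ℕ × ℕ // c ∈ ν.cells} ↪ A

namespace YoungTableau

variable {ν : YoungDiagram} {A : Type*}

/-- The subtableau of shape `μ ⊆ ν` of a tableau `T` of shape `ν`: the restriction of `T`. -/
def subtableau (T : YoungTableau ν A) {μ : YoungDiagram} (h : μ ≤ ν) : YoungTableau μ A where
  toFun c := T ⟨c.1, h c.2⟩
  inj' _ _ hxy := Subtype.ext (Subtype.mk.inj (T.injective hxy))

/-- The tableau obtained from `T` by removing its first `w` columns. -/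
def dropColumns (T : YoungTableau ν A) (w : ℕ) : YoungTableau (ν.dropColumns w) A where
  toFun c := T ⟨(c.1.1, c.1.2 + w), YoungDiagram.mem_of_mem_dropColumns c.2⟩
  inj' x y hxy := by
    have h := congrArg Subtype.val (T.injective hxy)
    simp only [Prod.mk.injEq, Nat.add_right_cancel_iff] at h
    exact Subtype.ext (Prod.ext h.1 h.2)

/-- The set of entries of the `i`-th row of `T`. -/
def row (T : YoungTableau ν A) (i : ℕ) : Set A :=
  {x | ∃ c, c.1.1 = i ∧ T c = x}

/-- The set of entries of the `j`-th column of `T`. -/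
def column (T : YoungTableau ν A) (j : ℕ) : Set A :=
  {x | ∃ c, c.1.2 = j ∧ T c = x}

/-- The set of entries of the `i`-th block of `T`. -/
noncomputable def block [DecidableEq A] (T : YoungTableau ν A) (i : Fin ν.numBlocks) : Finset A :=
  (Finset.univ.filter fun c : {c : ℕ × ℕ // c ∈ ν.cells} =>
    ν.colLen c.1.2 = ν.blockHeight i).image T

open scoped Pointwise in
/-- The row subgroup of `T`: the permutations of `A` that fix every element which is not an entry of
`T` and map each row of `T` onto itself (the internal product of the symmetric groups of the rows). -/
def rowSubgroup (T : YoungTableau ν A) : Subgroup (Equiv.Perm A) :=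
  fixingSubgroup (Equiv.Perm A) (Set.range T)ᶜ ⊓
    ⨅ i : ℕ, MulAction.stabilizer (Equiv.Perm A) (T.row i)

open scoped Pointwise in
/-- The column subgroup of `T`. -/
def columnSubgroup (T : YoungTableau ν A) : Subgroup (Equiv.Perm A) :=
  fixingSubgroup (Equiv.Perm A) (Set.range T)ᶜ ⊓
    ⨅ j : ℕ, MulAction.stabilizer (Equiv.Perm A) (T.column j)

variable [Fintype A] [DecidableEq A]

open Classical in
/-- The sum of the elements of the row subgroup. -/
noncomputable def rowSymmetrizer (K : Type*) [Field K] (T : YoungTableau ν A) :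
    MonoidAlgebra K (Equiv.Perm A) :=
  ∑ σ : Equiv.Perm A with σ ∈ T.rowSubgroup, MonoidAlgebra.of K (Equiv.Perm A) σ

open Classical in
/-- The signed sum of the elements of the column subgroup. -/
noncomputable def columnAntisymmetrizer (K : Type*) [Field K] (T : YoungTableau ν A) :
    MonoidAlgebra K (Equiv.Perm A) :=
  ∑ τ : Equiv.Perm A with τ ∈ T.columnSubgroup,
    ((Equiv.Perm.sign τ : ℤ) : K) • MonoidAlgebra.of K (Equiv.Perm A) τ

/-- The Young symmetrizer of `T`, in the group algebra of the symmetric group of `A`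
(permutations are multiplied as functions, from right to left). -/
noncomputable def youngSymmetrizer (K : Type*) [Field K] (T : YoungTableau ν A) :
    MonoidAlgebra K (Equiv.Perm A) :=
  T.rowSymmetrizer K * T.columnAntisymmetrizer K

/-- The sum of the transpositions `(a, b)`, for `b` in the `i`-th block of `T`. -/
noncomputable def blockSum (K : Type*) [Field K] (T : YoungTableau ν A) (a : A)
    (i : Fin ν.numBlocks) : MonoidAlgebra K (Equiv.Perm A) :=
  ∑ b ∈ T.block i, MonoidAlgebra.of K (Equiv.Perm A) (Equiv.swap a b)

end YoungTableau

/-!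
The proof uses no representation theory: it works with right multiplication by sums of
transpositions in the group algebra. Call *column relations* of a tableau (`ColumnRelations`) the
relations of its Specht module for an element `w`: a transposition in a column changes the sign of
`w`, and `w = ∑ w (b, d)`, where `d` runs over a column and `b` is an entry of another column which
is not higher. The Young symmetrizer of `T` satisfies those of `T`. Let `S` be `T` without the
corner `a`, and let `P` be the product of the factors `1 - x / r` of the theorem, one for each height
`h` of the columns to the right of `a`.

* If `w` satisfies the column relations of `T`, then `w P` satisfies those of `S`
  (`RemovalData.columnRelations`). Each `x` differs from a Jucys-Murphy type sum of the columns of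
  height at least `h` by a scalar, on what precedes it, so that `1 - x / r` kills an eigenspace of
  that sum; the failure of the exchange relations of `S` up to this factor lies in it. For two columns
  of `S` of equal height, of which `a` belonged to one, exchanges in one direction imply those in the
  other (`mul_starSum_eq_self_of_card_eq`).
* If `w` satisfies the column relations of `T`, then `w c(T) = α w`, with `α` the product of the hook
  lengths of `T` (`ColumnRelations.mul_youngSymmetrizer`). This goes by induction, removing the last
  entry `a` of the last row. Write `c(T) = (1 + R) c(S) (1 - Y)`, where `R` and `Y` are the sums of the
  transpositions of `a` with its row and its column. The exchange relations make `1 + R` the length of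
  the row; `w c(S) = w P c(S)` is a multiple of `w P` by induction; and `w P (1 - Y)` is the sum over
  the column of `a` of the elements `w P` with `a` replaced by the entries of that column, which the
  exchange relations evaluate (`ColumnRelations.sum_mul_layerProd`). The two scalars are the
  contributions of the row and the column of `a` to the quotient of the hook products.
* The row symmetrizer of `S` absorbs the factors of `P`, that is `w P c(S) = w c(S)`
  (`YoungTableau.mul_layerProd_mul_symmetrizer`): if `b` is in a row above `a`, and `d` is the entry of
  that row in the column of `a`, then `(a, b) (b, d) = (a, d) (a, b)`, where `(b, d)` is absorbed on
  the right and `(a, d)` changes the sign of `w`.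

For `w = c(T)` this gives `c(T) c(S) = c(T) P c(S) = α c(T) P`, with `α` the hook product of `S`.
-/

set_option linter.unusedSectionVars false

section YoungSymmetrizerProducts

open Finset

/-! ### Transpositions in the group algebra -/

section Transpositions

variable {K A : Type*} [Field K] [DecidableEq A]

/-- The transposition `(b, d)` as an element of the group algebra; it is `1` if `b = d`. -/
noncomputable def transp (K : Type*) {A : Type*} [Field K] [DecidableEq A] (b d : A) :
    MonoidAlgebra K (Equiv.Perm A) :=
  MonoidAlgebra.of K (Equiv.Perm A) (Equiv.swap b d)

/-- The sum of the transpositions `(c, e)`, for `e` in `U`. -/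
noncomputable def starSum (K : Type*) {A : Type*} [Field K] [DecidableEq A] (c : A)
    (U : Finset A) : MonoidAlgebra K (Equiv.Perm A) :=
  ∑ e ∈ U, transp K c e

theorem transp_comm (b d : A) : transp K b d = transp K d b := by
  rw [transp, Equiv.swap_comm, transp]

theorem transp_mul_self (b d : A) : transp K b d * transp K b d = 1 := by
  rw [transp, ← map_mul, Equiv.swap_mul_self, map_one]

theorem of_mul_transp (σ : Equiv.Perm A) (x y : A) :
    MonoidAlgebra.of K (Equiv.Perm A) σ * transp K x y =
      transp K (σ x) (σ y) * MonoidAlgebra.of K (Equiv.Perm A) σ := by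
  rw [transp, transp, ← map_mul, ← map_mul, Equiv.mul_swap_eq_swap_mul]

theorem transp_mul_transp (b d x y : A) :
    transp K b d * transp K x y =
      transp K (Equiv.swap b d x) (Equiv.swap b d y) * transp K b d :=
  of_mul_transp _ _ _

/-- Moving a transposition to the left past another one with which it shares an entry. -/
theorem transp_mul_transp_left {b d e : A} (hbe : b ≠ e) (hde : d ≠ e) :
    transp K b d * transp K b e = transp K d e * transp K b d := by
  rw [transp_mul_transp, Equiv.swap_apply_left, Equiv.swap_apply_of_ne_of_ne hbe.symm hde.symm]

theorem of_mul_starSum (σ : Equiv.Perm A) (c : A) (U : Finset A) :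
    MonoidAlgebra.of K (Equiv.Perm A) σ * starSum K c U =
      starSum K (σ c) (U.image σ) * MonoidAlgebra.of K (Equiv.Perm A) σ := by
  rw [starSum, starSum, sum_image (fun _ _ _ _ h => σ.injective h), mul_sum, sum_mul]
  exact sum_congr rfl fun e _ => of_mul_transp _ _ _

theorem image_swap_eq {b d : A} {U : Finset A} (h : b ∈ U ↔ d ∈ U) :
    U.image (Equiv.swap b d) = U := by
  ext x
  rw [mem_image]
  constructor
  · rintro ⟨y, hy, rfl⟩
    rcases eq_or_ne y b with rfl | hb
    · rw [Equiv.swap_apply_left]; exact h.1 hy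
    rcases eq_or_ne y d with rfl | hd
    · rw [Equiv.swap_apply_right]; exact h.2 hy
    rwa [Equiv.swap_apply_of_ne_of_ne hb hd]
  · intro hx
    refine ⟨Equiv.swap b d x, ?_, Equiv.swap_apply_self _ _ _⟩
    rcases eq_or_ne x b with rfl | hb
    · rw [Equiv.swap_apply_left]; exact h.1 hx
    rcases eq_or_ne x d with rfl | hd
    · rw [Equiv.swap_apply_right]; exact h.2 hx
    rwa [Equiv.swap_apply_of_ne_of_ne hb hd]

theorem commute_transp_starSum {b d c : A} {U : Finset A} (hb : b ≠ c) (hd : d ≠ c)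
    (h : b ∈ U ↔ d ∈ U) : Commute (transp K b d) (starSum K c U) := by
  rw [Commute, SemiconjBy, transp, of_mul_starSum, image_swap_eq h,
    Equiv.swap_apply_of_ne_of_ne hb.symm hd.symm]

theorem transp_mul_starSum {a b : A} {U : Finset A} (h : a ∈ U ↔ b ∈ U) :
    transp K a b * starSum K a U = starSum K b U * transp K a b := by
  rw [transp, of_mul_starSum, image_swap_eq h, Equiv.swap_apply_left]

theorem transp_mul_starSum_erase {a b : A} {U : Finset A} (ha : a ∈ U) (hb : b ∈ U) :
    transp K a b * starSum K a (U.erase a) = starSum K b (U.erase b) * transp K a b := by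
  rw [transp, of_mul_starSum, Finset.image_erase (Equiv.injective _), image_swap_eq (by tauto),
    Equiv.swap_apply_left]

theorem commute_starSum {b c : A} {U V : Finset A} (hbc : b ≠ c) (hcU : c ∉ U)
    (h : ∀ e ∈ U, (b ∈ V ↔ e ∈ V)) : Commute (starSum K b U) (starSum K c V) :=
  Commute.sum_left _ _ _ fun e he =>
    commute_transp_starSum hbc (by rintro rfl; exact hcU he) (h e he)

theorem starSum_union {c : A} {U V : Finset A} (h : Disjoint U V) :
    starSum K c (U ∪ V) = starSum K c U + starSum K c V :=
  sum_union h

theorem starSum_erase {c e : A} {U : Finset A} (he : e ∈ U) :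
    starSum K c (U.erase e) = starSum K c U - transp K c e :=
  sum_erase_eq_sub he

theorem starSum_biUnion {ι : Type*} {c : A} {s : Finset ι} {C : ι → Finset A}
    (h : (s : Set ι).PairwiseDisjoint C) :
    starSum K c (s.biUnion C) = ∑ i ∈ s, starSum K c (C i) :=
  sum_biUnion h

theorem mul_starSum (w : MonoidAlgebra K (Equiv.Perm A)) (c : A) (U : Finset A) :
    w * starSum K c U = ∑ e ∈ U, w * transp K c e :=
  mul_sum _ _ _

end Transpositions

/-! ### Two antisymmetric columns -/

section TwoColumns

variable {K A : Type*} [Field K] [DecidableEq A]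

/-- Right multiplication by a transposition of two entries in `U` changes the sign of `w`. -/
def AntisymmetricOn (U : Finset A) (w : MonoidAlgebra K (Equiv.Perm A)) : Prop :=
  ∀ b ∈ U, ∀ d ∈ U, b ≠ d → w * transp K b d = -w

namespace AntisymmetricOn

variable {U C C' : Finset A} {w : MonoidAlgebra K (Equiv.Perm A)}

theorem mul_starSum_erase (hw : AntisymmetricOn U w) {x : A} (hx : x ∈ U) :
    w * starSum K x (U.erase x) = (1 - #U : K) • w := by
  rw [mul_starSum, sum_congr rfl fun e he => hw x hx e (mem_of_mem_erase he) (ne_of_mem_erase he).symm,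
    sum_const, card_erase_of_mem hx, ← Nat.cast_smul_eq_nsmul K,
    Nat.cast_sub (card_pos.2 ⟨x, hx⟩), Nat.cast_one, smul_neg, ← neg_smul, neg_sub]

theorem mul_starSum_self (hw : AntisymmetricOn U w) {x : A} (hx : x ∈ U) :
    w * starSum K x U = (2 - #U : K) • w := by
  have h := hw.mul_starSum_erase hx
  rw [starSum_erase hx, mul_sub, transp, Equiv.swap_self, sub_eq_iff_eq_add] at h
  rw [h, show (Equiv.refl A : Equiv.Perm A) = 1 from rfl, map_one, mul_one]
  module

/-- The antisymmetrization of `w` over one more entry `b` is again antisymmetric. -/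
theorem insert_mul (hw : AntisymmetricOn U w) {b : A} (hb : b ∉ U) :
    AntisymmetricOn (insert b U) (w * (1 - starSum K b U)) := by
  have key : ∀ y ∈ U, w * (1 - starSum K b U) * transp K b y = -(w * (1 - starSum K b U)) := by
    intro y hy
    have h1 : ∀ e ∈ U.erase y, w * transp K b e * transp K b y = -(w * transp K b e) := by
      intro e he
      have hye := ne_of_mem_erase he
      have hbe : b ≠ e := by rintro rfl; exact hb (mem_of_mem_erase he)
      have hby : b ≠ y := by rintro rfl; exact hb hy
      rw [mul_assoc, transp_mul_transp_left hby hye, ← mul_assoc,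
        hw e (mem_of_mem_erase he) y hy hye, neg_mul]
    have h2 : w * starSum K b U = w * transp K b y + ∑ e ∈ U.erase y, w * transp K b e := by
      rw [mul_starSum, add_sum_erase U (fun e => w * transp K b e) hy]
    rw [mul_sub, mul_one, h2, sub_mul, add_mul, sum_mul, sum_congr rfl h1, mul_assoc,
      transp_mul_self, sum_neg_distrib, mul_one]
    abel
  intro x hx y hy hxy
  rcases mem_insert.1 hx with rfl | hxU
  · exact key y (mem_of_mem_insert_of_ne hy hxy.symm)
  rcases mem_insert.1 hy with rfl | hyU
  · rw [transp_comm]; exact key x hxU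
  have hc : Commute (transp K x y) (starSum K b U) :=
    commute_transp_starSum (by rintro rfl; exact hb hxU) (by rintro rfl; exact hb hyU) (by tauto)
  rw [mul_assoc, ← ((Commute.one_right _).sub_right hc).eq, ← mul_assoc, hw x hxU y hyU hxy, neg_mul]

theorem erase_mul (hw : AntisymmetricOn C w) {b : A} (hdisj : Disjoint C U) :
    AntisymmetricOn (C.erase b) (w * (1 - starSum K b U)) := by
  intro x hx y hy hxy
  have hc : Commute (transp K x y) (starSum K b U) :=
    commute_transp_starSum (ne_of_mem_erase hx) (ne_of_mem_erase hy) (by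
      have h1 := disjoint_left.1 hdisj (mem_of_mem_erase hx)
      have h2 := disjoint_left.1 hdisj (mem_of_mem_erase hy)
      tauto)
  rw [mul_assoc, ← ((Commute.one_right _).sub_right hc).eq, ← mul_assoc,
    hw x (mem_of_mem_erase hx) y (mem_of_mem_erase hy) hxy, neg_mul]

end AntisymmetricOn

theorem mul_pairSum_union {C C' : Finset A} {w : MonoidAlgebra K (Equiv.Perm A)}
    (hC : AntisymmetricOn C w) (hC' : AntisymmetricOn C' w) (hdisj : Disjoint C C') :
    w * ∑ x ∈ C ∪ C', starSum K x (C ∪ C') =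
      (2 * #C - #C ^ 2 + 2 * #C' - #C' ^ 2 : K) • w + 2 • ∑ x ∈ C, w * starSum K x C' := by
  have h1 : ∑ x ∈ C, w * starSum K x C = (2 * #C - #C ^ 2 : K) • w := by
    rw [sum_congr rfl fun x hx => hC.mul_starSum_self hx, sum_const, ← Nat.cast_smul_eq_nsmul K,
      smul_smul]
    congr 1; ring
  have h2 : ∑ x ∈ C', w * starSum K x C' = (2 * #C' - #C' ^ 2 : K) • w := by
    rw [sum_congr rfl fun x hx => hC'.mul_starSum_self hx, sum_const, ← Nat.cast_smul_eq_nsmul K,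
      smul_smul]
    congr 1; ring
  have h3 : ∑ x ∈ C', w * starSum K x C = ∑ x ∈ C, w * starSum K x C' := by
    simp_rw [mul_starSum]
    rw [sum_comm]
    exact sum_congr rfl fun x _ => sum_congr rfl fun y _ => by rw [transp_comm]
  rw [mul_sum, sum_union hdisj]
  simp_rw [starSum_union hdisj, mul_add]
  rw [sum_add_distrib, sum_add_distrib, h1, h2, h3]
  module

theorem erase_union_insert {C C' : Finset A} {b : A} (hb : b ∈ C) :
    C.erase b ∪ insert b C' = C ∪ C' := by
  rw [union_insert, ← insert_union, insert_erase hb]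

theorem disjoint_erase_insert {C C' : Finset A} (h : Disjoint C C') (b : A) :
    Disjoint (C.erase b) (insert b C') := by
  rw [disjoint_insert_right]
  exact ⟨notMem_erase _ _, h.mono_left (erase_subset _ _)⟩

theorem commute_transp_pairSum {V : Finset A} {b y : A} (hb : b ∈ V) (hy : y ∈ V) :
    Commute (transp K b y) (∑ x ∈ V, starSum K x V) := by
  rw [Commute, SemiconjBy, mul_sum, sum_mul]
  refine sum_equiv (Equiv.swap b y) (fun x => ?_) fun x _ => ?_
  · conv_rhs => rw [← image_swap_eq (b := b) (d := y) (U := V) (by tauto)]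
    simp only [mem_image, EmbeddingLike.apply_eq_iff_eq, exists_eq_right]
  · rw [transp, of_mul_starSum, image_swap_eq (by tauto)]

/-- On elements which are antisymmetric on two columns of `p ≤ q` entries, the largest eigenvalue of
the sum of `(x, y)` over all pairs of entries, with `(x, x) = 1`, is `4 p - p ^ 2 + 2 q - q ^ 2`, the one of
the shape with these two columns. -/
theorem eq_zero_of_two_columns [CharZero K] (p q : ℕ) (hpq : p ≤ q) (C C' : Finset A) (hC : #C = p)
    (hC' : #C' = q) (hdisj : Disjoint C C') (w : MonoidAlgebra K (Equiv.Perm A))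
    (hw : AntisymmetricOn C w) (hw' : AntisymmetricOn C' w) (z : ℤ)
    (hz : w * ∑ x ∈ C ∪ C', starSum K x (C ∪ C') = (z : K) • w)
    (hlt : 4 * p - p ^ 2 + 2 * q - q ^ 2 < z) : w = 0 := by
  -- Antisymmetrizing over `C'` and one entry of `C` gives columns of `p - 1` and `q + 1` entries,
  -- with a smaller bound; hence it kills `w`, which determines the eigenvalue.
  induction p generalizing C C' q w with
  | zero =>
    have hC0 := card_eq_zero.1 hC
    rw [mul_pairSum_union hw hw' hdisj, hC, hC', hC0, sum_empty, smul_zero, add_zero, ← sub_eq_zero,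
      ← sub_smul, smul_eq_zero] at hz
    refine hz.resolve_left fun h => ?_
    have : ((2 * q - q ^ 2 - z : ℤ) : K) = 0 := by
      push_cast at h ⊢; linear_combination h
    rw [Int.cast_eq_zero] at this
    push_cast at hlt
    linarith
  | succ p ih =>
    have hv : ∀ b ∈ C, w * starSum K b C' = w := by
      intro b hb
      have hbC' : b ∉ C' := disjoint_left.1 hdisj hb
      have hcomm : Commute (1 - starSum K b C') (∑ x ∈ C ∪ C', starSum K x (C ∪ C')) :=
        (Commute.one_left _).sub_left (Commute.sum_left _ _ _ fun y hy =>
          commute_transp_pairSum (mem_union_left _ hb) (mem_union_right _ hy))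
      have h0 := ih (q + 1) (by omega) (C.erase b) (insert b C')
        (by rw [card_erase_of_mem hb, hC]; rfl) (by rw [card_insert_of_notMem hbC', hC'])
        (disjoint_erase_insert hdisj b)
        (w * (1 - starSum K b C')) (hw.erase_mul hdisj) (hw'.insert_mul hbC')
        (by rw [erase_union_insert hb, mul_assoc, hcomm.eq, ← mul_assoc, hz, smul_mul_assoc])
        (by push_cast at hlt ⊢; nlinarith)
      rw [mul_sub, mul_one, sub_eq_zero] at h0
      exact h0.symm
    rw [mul_pairSum_union hw hw' hdisj, hC, hC', sum_congr rfl hv, sum_const, hC,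
      ← Nat.cast_smul_eq_nsmul K, ← Nat.cast_smul_eq_nsmul K, smul_smul, ← add_smul, ← sub_eq_zero,
      ← sub_smul, smul_eq_zero] at hz
    refine hz.resolve_left fun h => ?_
    have : ((4 * (p + 1 : ℕ) - (p + 1 : ℕ) ^ 2 + 2 * q - q ^ 2 - z : ℤ) : K) = 0 := by
      push_cast at h ⊢; linear_combination h
    rw [Int.cast_eq_zero] at this
    linarith

/-- For two columns of the same height, the exchange relation of the entries of the second column
with the first one implies the exchange relation in the other direction. -/
theorem mul_starSum_eq_self_of_card_eq [CharZero K] {C C' : Finset A}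
    {w : MonoidAlgebra K (Equiv.Perm A)} (hw : AntisymmetricOn C w) (hw' : AntisymmetricOn C' w)
    (hdisj : Disjoint C C') (hcard : #C = #C') (h : ∀ y ∈ C', w * starSum K y C = w) {b : A}
    (hb : b ∈ C) : w * starSum K b C' = w := by
  have hbC' : b ∉ C' := disjoint_left.1 hdisj hb
  have hpos : 0 < #C := card_pos.2 ⟨b, hb⟩
  have hcomm : Commute (1 - starSum K b C') (∑ x ∈ C ∪ C', starSum K x (C ∪ C')) :=
    (Commute.one_left _).sub_left (Commute.sum_left _ _ _ fun y hy =>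
      commute_transp_pairSum (mem_union_left _ hb) (mem_union_right _ hy))
  have hz : w * ∑ x ∈ C ∪ C', starSum K x (C ∪ C') =
      ((6 * #C - 2 * #C ^ 2 : ℤ) : K) • w := by
    rw [union_comm C C', mul_pairSum_union hw' hw hdisj.symm, sum_congr rfl h, sum_const, ← hcard,
      ← Nat.cast_smul_eq_nsmul K, ← Nat.cast_smul_eq_nsmul K, smul_smul, ← add_smul]
    congr 1; push_cast; ring
  -- The eigenvalue is the one of two columns of `#C` entries, too large for `#C - 1` and `#C + 1`.
  have h0 := eq_zero_of_two_columns (#C - 1) (#C + 1) (by omega) (C.erase b) (insert b C')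
    (card_erase_of_mem hb) (by rw [card_insert_of_notMem hbC', hcard])
    (disjoint_erase_insert hdisj b)
    (w * (1 - starSum K b C')) (hw.erase_mul hdisj) (hw'.insert_mul hbC')
    (6 * #C - 2 * #C ^ 2)
    (by rw [erase_union_insert hb, mul_assoc, hcomm.eq, ← mul_assoc, hz, smul_mul_assoc])
    (by push_cast [Nat.cast_sub hpos]; nlinarith)
  rw [mul_sub, mul_one, sub_eq_zero] at h0
  exact h0.symm

end TwoColumns

/-! ### Column relations and removal of an entry -/

section ColumnRelations

variable {K A ι : Type*} [Field K] [DecidableEq A]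

/-- The defining relations of the Specht module with columns `C j`: antisymmetry in each column, and
the exchange of an entry with all the entries of another column which is at least as high. -/
structure ColumnRelations (C : ι → Finset A) (w : MonoidAlgebra K (Equiv.Perm A)) : Prop where
  antisymm : ∀ j, AntisymmetricOn (C j) w
  exchange : ∀ i j, i ≠ j → #(C j) ≤ #(C i) → ∀ b ∈ C j, w * starSum K b (C i) = w

/-- The `C j` are disjoint, and those with `j` outside `s` are empty. -/
structure IsColumnFamily (s : Finset ι) (C : ι → Finset A) : Prop where
  disjoint : Pairwise fun i j => Disjoint (C i) (C j)
  eq_empty : ∀ j, j ∉ s → C j = ∅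

/-- The union of the columns of height at least `h`. -/
def upper (s : Finset ι) (C : ι → Finset A) (h : ℕ) : Finset A :=
  (s.filter fun j => h ≤ #(C j)).biUnion C

/-- The union of the columns of height `h`. -/
def layer (s : Finset ι) (C : ι → Finset A) (h : ℕ) : Finset A :=
  (s.filter fun j => #(C j) = h).biUnion C

/-- The eigenvalue of the sum of the transpositions with one entry in a column of height `h` and the
other one in `upper s C h`: the content of the last cell of the last column of height `h`. -/
def contentGE (K : Type*) [Field K] (s : Finset ι) (C : ι → Finset A) (h : ℕ) : K :=
  (#(s.filter fun j => h ≤ #(C j)) : K) - h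

/-- The axial distance between the last cells of the last columns of heights `h` and `p`. -/
def axialDist (K : Type*) [Field K] (s : Finset ι) (C : ι → Finset A) (p h : ℕ) : K :=
  contentGE K s C h - contentGE K s C p

/-- The factor `1 - x / r` where `x` is the sum of the transpositions of `c` with the entries of the
columns of height `h` and `r` is the axial distance. -/
noncomputable def layerFactor (K : Type*) [Field K] (s : Finset ι) (C : ι → Finset A) (p : ℕ) (c : A)
    (h : ℕ) : MonoidAlgebra K (Equiv.Perm A) :=
  1 - (axialDist K s C p h)⁻¹ • starSum K c (layer s C h)

/-- The product of the factors `layerFactor K s C p c i`, for `i` decreasing from `p - 1` to `h`. -/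
noncomputable def layerProd (K : Type*) [Field K] (s : Finset ι) (C : ι → Finset A) (p : ℕ) (c : A)
    (h : ℕ) : MonoidAlgebra K (Equiv.Perm A) :=
  ((List.range (p - h)).map fun i => layerFactor K s C p c (p - 1 - i)).prod

variable {s : Finset ι} {C : ι → Finset A} {p h t : ℕ} {a b c d : A}
  {w y g : MonoidAlgebra K (Equiv.Perm A)}

theorem layerProd_self : layerProd K s C p c p = 1 := by simp [layerProd]

theorem layerProd_eq_mul (hp : h < p) :
    layerProd K s C p c h = layerProd K s C p c (h + 1) * layerFactor K s C p c h := by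
  have h1 : p - h = p - (h + 1) + 1 := by omega
  have h2 : p - 1 - (p - (h + 1)) = h := by omega
  rw [layerProd, h1, List.range_succ, List.map_append, List.prod_append, layerProd]
  simp [h2]

theorem mul_layerProd_eq (hp : h < p) :
    w * layerProd K s C p c h = w * layerProd K s C p c (h + 1) -
      (axialDist K s C p h)⁻¹ • (w * layerProd K s C p c (h + 1) * starSum K c (layer s C h)) := by
  rw [layerProd_eq_mul hp, ← mul_assoc, layerFactor, mul_sub, mul_one, mul_smul_comm]

theorem commute_layerFactor (hy : Commute y (starSum K c (layer s C h))) :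
    Commute y (layerFactor K s C p c h) :=
  (Commute.one_right _).sub_right (hy.smul_right _)

theorem commute_layerProd (hp : h ≤ p)
    (hy : ∀ i, h ≤ i → i < p → Commute y (starSum K c (layer s C i))) :
    Commute y (layerProd K s C p c h) := by
  refine Nat.decreasingInduction' (P := fun k => Commute y (layerProd K s C p c k))
    (fun k hk hhk ih => ?_) hp ?_
  · rw [layerProd_eq_mul hk]
    exact ih.mul_right (commute_layerFactor (hy k hhk hk))
  · rw [layerProd_self]; exact Commute.one_right _

theorem transp_mul_layerProd (hp : h ≤ p)
    (hab : ∀ i, h ≤ i → i < p → (a ∈ layer s C i ↔ b ∈ layer s C i)) :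
    transp K a b * layerProd K s C p a h = layerProd K s C p b h * transp K a b := by
  refine Nat.decreasingInduction' (P := fun k => transp K a b * layerProd K s C p a k =
    layerProd K s C p b k * transp K a b) (fun k hk hhk ih => ?_) hp ?_
  · rw [layerProd_eq_mul hk, layerProd_eq_mul hk, ← mul_assoc, ih, mul_assoc, mul_assoc]
    congr 1
    rw [layerFactor, layerFactor, mul_sub, sub_mul, mul_one, one_mul, mul_smul_comm, smul_mul_assoc,
      transp_mul_starSum (hab k hhk hk)]
  · rw [layerProd_self, layerProd_self, mul_one, one_mul]

namespace IsColumnFamily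

variable {i j : ι}

theorem mem_index (hC : IsColumnFamily s C) (hb : b ∈ C j) : j ∈ s := by
  by_contra hj
  rw [hC.eq_empty j hj] at hb
  exact notMem_empty _ hb

theorem index_unique (hC : IsColumnFamily s C) (hi : b ∈ C i) (hj : b ∈ C j) : i = j := by
  by_contra hij
  exact disjoint_left.1 (hC.disjoint hij) hi hj

theorem mem_upper (hC : IsColumnFamily s C) (hb : b ∈ C j) : b ∈ upper s C h ↔ h ≤ #(C j) := by
  simp only [upper, mem_biUnion, mem_filter]
  constructor
  · rintro ⟨i, ⟨-, hi⟩, hbi⟩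
    rwa [hC.index_unique hb hbi]
  · exact fun hh => ⟨j, ⟨hC.mem_index hb, hh⟩, hb⟩

theorem mem_layer (hC : IsColumnFamily s C) (hb : b ∈ C j) : b ∈ layer s C h ↔ #(C j) = h := by
  simp only [layer, mem_biUnion, mem_filter]
  constructor
  · rintro ⟨i, ⟨-, hi⟩, hbi⟩
    rwa [hC.index_unique hb hbi]
  · exact fun hh => ⟨j, ⟨hC.mem_index hb, hh⟩, hb⟩

theorem exists_of_mem_layer (hb : b ∈ layer s C h) : ∃ j, b ∈ C j ∧ #(C j) = h := by
  simp only [layer, mem_biUnion, mem_filter] at hb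
  obtain ⟨j, ⟨-, hj⟩, hbj⟩ := hb
  exact ⟨j, hbj, hj⟩

theorem upper_eq (s : Finset ι) (C : ι → Finset A) (h : ℕ) :
    upper s C h = upper s C (h + 1) ∪ layer s C h := by
  classical
  rw [upper, upper, layer, ← union_biUnion, ← filter_or]
  congr 1
  exact filter_congr fun j _ => by omega

theorem disjoint_upper_layer (hC : IsColumnFamily s C) (h : ℕ) :
    Disjoint (upper s C (h + 1)) (layer s C h) := by
  rw [disjoint_right]
  intro x hx hx'
  obtain ⟨j, hj, hjh⟩ := exists_of_mem_layer hx
  rw [hC.mem_upper hj] at hx'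
  omega

/-- Transpositions of entries of columns of the same kind commute with the sums over layers. -/
theorem commute_layer (hC : IsColumnFamily s C) (hb : b ∈ C i) (hd : d ∈ C j) (hbc : b ≠ c)
    (hdc : d ≠ c) (hh : #(C i) = h ↔ #(C j) = h) :
    Commute (transp K b d) (starSum K c (layer s C h)) :=
  commute_transp_starSum hbc hdc (by rw [hC.mem_layer hb, hC.mem_layer hd, hh])

theorem commute_upper (hC : IsColumnFamily s C) (hb : b ∈ C i) (hd : d ∈ C j) (hbc : b ≠ c)
    (hdc : d ≠ c) (hi : h ≤ #(C i)) (hj : h ≤ #(C j)) :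
    Commute (transp K b d) (starSum K c ((upper s C h).erase c)) :=
  commute_transp_starSum hbc hdc (by
    rw [mem_erase, mem_erase, hC.mem_upper hb, hC.mem_upper hd]; tauto)

end IsColumnFamily

namespace ColumnRelations

variable {i j v : ι}

theorem mul_starSum_upper (hw : ColumnRelations C w) (hC : IsColumnFamily s C) (hb : b ∈ C j) :
    w * starSum K b ((upper s C #(C j)).erase b) = contentGE K s C #(C j) • w := by
  classical
  have hmem : b ∈ upper s C #(C j) := (hC.mem_upper hb).2 le_rfl
  have hj : j ∈ s.filter fun i => #(C j) ≤ #(C i) := mem_filter.2 ⟨hC.mem_index hb, le_rfl⟩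
  rw [starSum_erase hmem, upper, starSum_biUnion fun i _ k _ hik => hC.disjoint hik, mul_sub, mul_sum,
    ← add_sum_erase _ _ hj, (hw.antisymm j).mul_starSum_self hb,
    sum_congr rfl fun i hi => hw.exchange i j (ne_of_mem_erase hi)
      (mem_filter.1 (mem_of_mem_erase hi)).2 b hb,
    sum_const, card_erase_of_mem hj, ← Nat.cast_smul_eq_nsmul K,
    Nat.cast_sub (card_pos.2 ⟨j, hj⟩), transp, Equiv.swap_self,
    show (Equiv.refl A : Equiv.Perm A) = 1 from rfl, map_one, mul_one, contentGE]
  module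

theorem mul_starSum_layer (hw : ColumnRelations C w) (hC : IsColumnFamily s C) (hb : b ∈ C j)
    (hlt : #(C j) < h) :
    w * starSum K b (layer s C h) = (#(s.filter fun i => #(C i) = h) : K) • w := by
  rw [layer, starSum_biUnion fun i _ k _ hik => hC.disjoint hik, mul_sum,
    sum_congr rfl fun i hi => hw.exchange i j (by rintro rfl; simp at hi; omega)
      (by simp at hi; omega) b hb, sum_const, Nat.cast_smul_eq_nsmul]

end ColumnRelations

/-- The data of a column family, an entry `a` of one of its columns, and the relations for `w`. -/
structure RemovalData (s : Finset ι) (C : ι → Finset A) (v : ι) (a : A)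
    (w : MonoidAlgebra K (Equiv.Perm A)) : Prop where
  family : IsColumnFamily s C
  rel : ColumnRelations C w
  mem : a ∈ C v

section Distance

variable [CharZero K]

theorem axialDist_ne_zero (hlt : h < p) : axialDist K s C p h ≠ 0 := by
  have hsub : (s.filter fun j => p ≤ #(C j)) ⊆ s.filter fun j => h ≤ #(C j) :=
    fun j hj => by simp only [mem_filter] at hj ⊢; exact ⟨hj.1, by omega⟩
  have hcard := card_le_card hsub
  rw [axialDist, contentGE, contentGE]
  intro h0
  have : ((#(s.filter fun j => h ≤ #(C j)) + p : ℕ) : K) = (#(s.filter fun j => p ≤ #(C j)) + h : ℕ) := by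
    push_cast; linear_combination h0
  rw [Nat.cast_inj] at this
  omega

end Distance

namespace RemovalData

variable {i j v : ι} {k m : ℕ}

/-- For an entry `b` of a lower column, `w (a, b)` times the preceding factors is an eigenvector of the
sum of the transpositions of `a` with the columns as high as the one of `b`. -/
theorem mul_transp_mul_starSum (H : RemovalData s C v a w) (hb : b ∈ C j) (hj : #(C j) < m)
    (hm : m ≤ #(C v)) :
    w * layerProd K s C #(C v) a m * transp K a b * starSum K a ((upper s C #(C j)).erase a) =
      contentGE K s C #(C j) • (w * layerProd K s C #(C v) a m * transp K a b) := by
  have hC := H.family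
  have hab : b ≠ a := by
    rintro rfl
    rw [hC.index_unique hb H.mem] at hj; omega
  have hcomm : Commute (starSum K b ((upper s C #(C j)).erase b)) (layerProd K s C #(C v) a m) := by
    refine commute_layerProd hm fun i hi hip => ?_
    refine (commute_starSum hab.symm ?_ fun e he => ?_).symm
    · rw [hC.mem_layer hb]; omega
    · obtain ⟨l, hl, hli⟩ := IsColumnFamily.exists_of_mem_layer he
      have hbe : e ≠ b := by
        rintro rfl
        rw [hC.index_unique hb hl] at hj; omega
      simp only [mem_erase, hC.mem_upper H.mem, hC.mem_upper hl, ne_eq, hab.symm, hbe,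
        not_false_eq_true, true_and]
      omega
  rw [mul_assoc, transp_mul_starSum_erase ((hC.mem_upper H.mem).2 (by omega))
    ((hC.mem_upper hb).2 le_rfl), ← mul_assoc, mul_assoc w, ← hcomm.eq, ← mul_assoc,
    H.rel.mul_starSum_upper hC hb, smul_mul_assoc, smul_mul_assoc]

theorem mul_starSum_layer_mul_starSum (H : RemovalData s C v a w) (hh : h < #(C v)) :
    w * layerProd K s C #(C v) a (h + 1) * starSum K a (layer s C h) *
        starSum K a ((upper s C h).erase a) =
      contentGE K s C h •
        (w * layerProd K s C #(C v) a (h + 1) * starSum K a (layer s C h)) := by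
  rw [mul_starSum _ a (layer s C h), sum_mul, smul_sum]
  refine sum_congr rfl fun b hb => ?_
  obtain ⟨j, hj, rfl⟩ := IsColumnFamily.exists_of_mem_layer hb
  exact H.mul_transp_mul_starSum hj (Nat.lt_succ_self _) hh

theorem starSum_layer_eq (H : RemovalData s C v a w) (hh : h < #(C v)) :
    starSum K a (layer s C h) =
      starSum K a ((upper s C h).erase a) - starSum K a ((upper s C (h + 1)).erase a) := by
  have h1 : a ∈ upper s C h := (H.family.mem_upper H.mem).2 hh.le
  have h2 : a ∈ upper s C (h + 1) := (H.family.mem_upper H.mem).2 hh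
  rw [starSum_erase h1, starSum_erase h2, IsColumnFamily.upper_eq s C h,
    starSum_union (H.family.disjoint_upper_layer h)]
  abel

theorem mul_layerProd_mul_eq_zero_of_le (hht : h ≤ t) (ht : t ≤ p)
    (hcomm : ∀ i, h ≤ i → i < t → Commute y (starSum K a (layer s C i)))
    (h0 : w * layerProd K s C p a t * y = 0) : w * layerProd K s C p a h * y = 0 := by
  refine Nat.decreasingInduction' (P := fun k => w * layerProd K s C p a k * y = 0)
    (fun k hk hhk ih => ?_) hht h0
  rw [layerProd_eq_mul (hk.trans_le ht), ← mul_assoc, mul_assoc _ _ y,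
    ← (commute_layerFactor (hcomm k hhk hk)).eq, ← mul_assoc, ih, zero_mul]

variable [CharZero K]

/-- After the factors up to height `h`, the sum of the transpositions of `a` with the other entries of
the columns of height at least `h` still acts by the content of `a`. -/
theorem mul_layerProd_mul_starSum_upper (H : RemovalData s C v a w) (hh : h ≤ #(C v)) :
    w * layerProd K s C #(C v) a h * starSum K a ((upper s C h).erase a) =
      contentGE K s C #(C v) • (w * layerProd K s C #(C v) a h) := by
  refine Nat.decreasingInduction' (P := fun k => w * layerProd K s C #(C v) a k *
    starSum K a ((upper s C k).erase a) = contentGE K s C #(C v) • (w * layerProd K s C #(C v) a k))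
    (fun k hk hhk ih => ?_) hh ?_
  · have hr := axialDist_ne_zero (K := K) (s := s) (C := C) hk
    have h1 := H.mul_starSum_layer_mul_starSum hk
    have h2 : starSum K a ((upper s C k).erase a) =
        starSum K a (layer s C k) + starSum K a ((upper s C (k + 1)).erase a) := by
      rw [H.starSum_layer_eq hk, sub_add_cancel]
    have h3 : contentGE K s C k = axialDist K s C #(C v) k + contentGE K s C #(C v) := by
      rw [axialDist]; ring
    rw [mul_layerProd_eq hk, sub_mul, smul_mul_assoc, h1, h2, mul_add, ih, h3, smul_smul, mul_add,
      inv_mul_cancel₀ hr]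
    module
  · rw [layerProd_self, mul_one]
    exact H.rel.mul_starSum_upper H.family H.mem

theorem mul_starSum_layer_eq (H : RemovalData s C v a w) (hh : h < #(C v)) :
    w * layerProd K s C #(C v) a (h + 1) * starSum K a (layer s C h) =
      w * layerProd K s C #(C v) a (h + 1) * starSum K a ((upper s C h).erase a) -
        contentGE K s C #(C v) • (w * layerProd K s C #(C v) a (h + 1)) := by
  rw [H.starSum_layer_eq hh, mul_sub, H.mul_layerProd_mul_starSum_upper hh]

/-- The factor for the columns of height `t` acts on `W`, the product with the preceding factors, as a
multiple of `contentGE K s C t - X`, where `X` is the sum of the transpositions of `a` with the other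
entries of the columns of height at least `t`. So it kills `W y` if this is an eigenvector of `X`
with the content of height `t` as eigenvalue. -/
theorem mul_layerProd_mul_eq_zero (H : RemovalData s C v a w) (ht : t < #(C v))
    (hcomm : Commute y (starSum K a ((upper s C t).erase a)))
    (heig : w * layerProd K s C #(C v) a (t + 1) * y * starSum K a ((upper s C t).erase a) =
      contentGE K s C t • (w * layerProd K s C #(C v) a (t + 1) * y)) :
    w * layerProd K s C #(C v) a t * y = 0 := by
  have hr := axialDist_ne_zero (K := K) (s := s) (C := C) ht
  have h3 : contentGE K s C t = axialDist K s C #(C v) t + contentGE K s C #(C v) := by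
    rw [axialDist]; ring
  rw [mul_layerProd_eq ht, sub_mul, smul_mul_assoc, H.mul_starSum_layer_eq ht, sub_mul,
    mul_assoc _ (starSum K a ((upper s C t).erase a)) y, ← hcomm.eq, ← mul_assoc, heig,
    smul_mul_assoc, h3, ← sub_smul, add_sub_cancel_right, smul_smul,
    inv_mul_cancel₀ hr, one_smul, sub_self]

/-- If `b` is an entry of a column of height `t`, the transpositions of `a` with the entries of the
columns of height between `t` and `k` can be moved to the left of `(a, b)`, where they become
transpositions of `b`, and these act on `w` by scalars. -/
theorem exists_mul_layerProd_mul_eq (H : RemovalData s C v a w) (hb : b ∈ C j)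
    {z : MonoidAlgebra K (Equiv.Perm A)} (hk : #(C j) < k) (hkm : k ≤ m) (hm : m ≤ #(C v))
    (hy : ∀ i, #(C j) < i → i < k → Commute y (starSum K a (layer s C i)))
    (hz : ∀ i, #(C j) < i → i < k → Commute z (starSum K a (layer s C i))) (r : K)
    (h0 : w * layerProd K s C #(C v) a k * y =
      r • (w * layerProd K s C #(C v) a m * transp K a b * z)) :
    ∃ r : K, w * layerProd K s C #(C v) a (#(C j) + 1) * y =
      r • (w * layerProd K s C #(C v) a m * transp K a b * z) := by
  have hC := H.family
  have hab : b ≠ a := by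
    rintro rfl
    rw [hC.index_unique hb H.mem] at hk; omega
  refine Nat.decreasingInduction' (P := fun n => ∃ r : K, w * layerProd K s C #(C v) a n * y =
      r • (w * layerProd K s C #(C v) a m * transp K a b * z))
    (fun n hnk hhn ih => ?_) hk ⟨r, h0⟩
  obtain ⟨q, hq⟩ := ih
  have hn : n < #(C v) := by omega
  have hcomm : Commute (starSum K b (layer s C n)) (layerProd K s C #(C v) a m) := by
    refine commute_layerProd hm fun i hi hip => ?_
    refine commute_starSum hab ?_ fun e he => ?_
    · rw [hC.mem_layer H.mem]; omega
    · obtain ⟨l, hl, hli⟩ := IsColumnFamily.exists_of_mem_layer he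
      rw [hC.mem_layer hb, hC.mem_layer hl]; omega
  have h1 : w * layerProd K s C #(C v) a m * transp K a b * z * starSum K a (layer s C n) =
      (#(s.filter fun i => #(C i) = n) : K) •
        (w * layerProd K s C #(C v) a m * transp K a b * z) := by
    rw [mul_assoc, (hz n (by omega) hnk).eq, ← mul_assoc, mul_assoc _ (transp K a b),
      transp_mul_starSum (by rw [hC.mem_layer H.mem, hC.mem_layer hb]; omega), ← mul_assoc,
      mul_assoc w, ← hcomm.eq, ← mul_assoc, H.rel.mul_starSum_layer hC hb (by omega),
      smul_mul_assoc, smul_mul_assoc, smul_mul_assoc]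
  refine ⟨q - (axialDist K s C #(C v) n)⁻¹ * (q * #(s.filter fun i => #(C i) = n)), ?_⟩
  rw [layerProd_eq_mul hn, ← mul_assoc, mul_assoc _ _ y,
    ← (commute_layerFactor (hy n (by omega) hnk)).eq, ← mul_assoc, hq, layerFactor, mul_sub, mul_one,
    mul_smul_comm, smul_mul_assoc, h1]
  module

/-- The conclusion of the eigenvector argument for an entry `b` of a column of height `t < p`. -/
theorem mul_layerProd_mul_eq_zero_of_eq (H : RemovalData s C v a w) (hb : b ∈ C j)
    {z : MonoidAlgebra K (Equiv.Perm A)} (hk : #(C j) < k) (hkm : k ≤ m) (hm : m ≤ #(C v))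
    (hy : ∀ i, i ≠ #(C j) → i < k → Commute y (starSum K a (layer s C i)))
    (hz : ∀ i, #(C j) < i → i < k → Commute z (starSum K a (layer s C i)))
    (hyu : Commute y (starSum K a ((upper s C #(C j)).erase a)))
    (hzu : Commute z (starSum K a ((upper s C #(C j)).erase a))) (r : K)
    (h0 : w * layerProd K s C #(C v) a k * y =
      r • (w * layerProd K s C #(C v) a m * transp K a b * z)) (hh : h ≤ #(C j)) :
    w * layerProd K s C #(C v) a h * y = 0 := by
  obtain ⟨q, hq⟩ := H.exists_mul_layerProd_mul_eq hb hk hkm hm (fun i hi hik => hy i (by omega) hik)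
    hz r h0
  refine mul_layerProd_mul_eq_zero_of_le hh (by omega) (fun i _ hi => hy i (by omega) (by omega))
    (H.mul_layerProd_mul_eq_zero (by omega) hyu ?_)
  rw [hq, smul_mul_assoc, mul_assoc, hzu.eq, ← mul_assoc, H.mul_transp_mul_starSum hb (by omega) hm,
    smul_mul_assoc, smul_comm]

end RemovalData

end ColumnRelations

section Removal

variable {K A ι : Type*} [Field K] [CharZero K] [DecidableEq A] [DecidableEq ι]
  {s : Finset ι} {C : ι → Finset A} {v i j : ι} {a b d : A} {h t p : ℕ}
  {w : MonoidAlgebra K (Equiv.Perm A)}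

/-- The columns after the entry `a` has been removed from the column `v`. -/
def eraseEntry (C : ι → Finset A) (v : ι) (a : A) : ι → Finset A :=
  Function.update C v ((C v).erase a)

theorem eraseEntry_self : eraseEntry C v a v = (C v).erase a := Function.update_self ..

theorem eraseEntry_of_ne (h : j ≠ v) : eraseEntry C v a j = C j := Function.update_of_ne h ..

namespace RemovalData

theorem mem_eraseEntry (H : RemovalData s C v a w) : b ∈ eraseEntry C v a j ↔ b ∈ C j ∧ b ≠ a := by
  rcases eq_or_ne j v with rfl | hj
  · rw [eraseEntry_self, mem_erase, and_comm]
  · rw [eraseEntry_of_ne hj]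
    refine ⟨fun hb => ⟨hb, ?_⟩, And.left⟩
    rintro rfl
    exact hj (H.family.index_unique hb H.mem)

theorem commute_starSum_layer (H : RemovalData s C v a w) (hb : b ∈ eraseEntry C v a j)
    (hh : #(C j) = h ↔ #(C i) = h) :
    Commute (1 - starSum K b (eraseEntry C v a i)) (starSum K a (layer s C h)) := by
  refine (Commute.one_left _).sub_left (Commute.sum_left _ _ _ fun e he => ?_)
  rw [H.mem_eraseEntry] at hb he
  exact H.family.commute_layer hb.1 he.1 hb.2 he.2 hh

theorem commute_starSum_upper (H : RemovalData s C v a w) (hb : b ∈ eraseEntry C v a j)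
    (hj : h ≤ #(C j)) (hi : h ≤ #(C i)) :
    Commute (1 - starSum K b (eraseEntry C v a i)) (starSum K a ((upper s C h).erase a)) := by
  refine (Commute.one_left _).sub_left (Commute.sum_left _ _ _ fun e he => ?_)
  rw [H.mem_eraseEntry] at hb he
  exact H.family.commute_upper hb.1 he.1 hb.2 he.2 hj hi

theorem mul_layerProd_mul_eq_zero_of_commute (H : RemovalData s C v a w) (hij : i ≠ j) (hi : i ≠ v)
    (hji : #(C j) ≤ #(C i)) (hb : b ∈ eraseEntry C v a j) (hh : h ≤ #(C v))
    (hk : ∀ k, h ≤ k → k < #(C v) → (#(C j) = k ↔ #(C i) = k)) :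
    w * layerProd K s C #(C v) a h * (1 - starSum K b (eraseEntry C v a i)) = 0 := by
  rw [mul_assoc, ← (commute_layerProd hh fun k hhk hkp =>
      H.commute_starSum_layer hb (hk k hhk hkp)).eq,
    ← mul_assoc, eraseEntry_of_ne hi, mul_sub, mul_one,
    H.rel.exchange i j hij hji b (H.mem_eraseEntry.1 hb).1, sub_self, zero_mul]

/-- Exchanges with the column from which the entry `a` has been removed. -/
theorem exchange_erased (H : RemovalData s C v a w) (hj : #(C j) < #(C v)) (hb : b ∈ C j)
    (hh : h ≤ #(C j)) :
    w * layerProd K s C #(C v) a h * (1 - starSum K b ((C v).erase a)) = 0 := by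
  have hjv : j ≠ v := by rintro rfl; omega
  have hb' : b ∈ eraseEntry C v a j := by rwa [eraseEntry_of_ne hjv]
  rw [← eraseEntry_self (C := C) (v := v) (a := a)]
  refine H.mul_layerProd_mul_eq_zero_of_eq hb (z := 1) hj le_rfl le_rfl
    (fun k hk hkv => H.commute_starSum_layer hb' (by omega))
    (fun _ _ _ => Commute.one_left _) (H.commute_starSum_upper hb' le_rfl hj.le)
    (Commute.one_left _) 1 ?_ hh
  -- The exchange relation of `b` with the whole column of `a` leaves `w (a, b)`.
  rw [layerProd_self, mul_one, eraseEntry_self, starSum_erase H.mem, one_smul, mul_one, mul_sub,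
    mul_sub, H.rel.exchange v j hjv.symm hj.le b hb, transp_comm]
  simp

/-- The commutator of two sums of transpositions over the column `i` and its layer. -/
theorem starSum_layer_mul_starSum (H : RemovalData s C v a w) (hij : i ≠ j) (hi : i ≠ v)
    (hb : b ∈ C j) (hba : b ≠ a) (hji : #(C j) ≠ #(C i)) :
    starSum K a (layer s C #(C i)) * starSum K b (C i) =
      starSum K b (C i) * starSum K a (layer s C #(C i)) - transp K a b * starSum K b (C i) +
        starSum K b (C i) * transp K a b := by
  have hC := H.family
  rw [show starSum K b (C i) = ∑ d ∈ C i, transp K b d from rfl, mul_sum, sum_mul (C i), mul_sum,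
    sum_mul (C i)]
  rw [← sum_sub_distrib, ← sum_add_distrib]
  refine sum_congr rfl fun d hd => ?_
  have hdl : d ∈ layer s C #(C i) := (hC.mem_layer hd).2 rfl
  have hda : d ≠ a := by rintro rfl; exact hi (hC.index_unique hd H.mem)
  have hbd : b ≠ d := by rintro rfl; exact hij (hC.index_unique hd hb)
  have hc : Commute (transp K b d) (starSum K a ((layer s C #(C i)).erase d)) :=
    commute_transp_starSum hba hda (by simp [hC.mem_layer hb, hji])
  have h1 : transp K b d * transp K a d = transp K a b * transp K b d := by
    rw [transp_comm b d, transp_comm a d, transp_mul_transp_left hda hba, transp_comm a b]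
  have h2 : transp K a d * transp K b d = transp K b d * transp K a b := by
    rw [transp_comm a b, transp_mul_transp_left hba hda, transp_comm d a]
  change starSum K a (layer s C #(C i)) * _ = _ * starSum K a (layer s C #(C i)) - _ + _
  have h3 : starSum K a (layer s C #(C i)) =
      starSum K a ((layer s C #(C i)).erase d) + transp K a d := by
    rw [starSum_erase hdl, sub_add_cancel]
  rw [h3, add_mul, mul_add, hc.eq, h1, h2]
  abel

/-- Exchanges between two columns which are both lower than the column of the removed entry. -/
theorem exchange_lower (H : RemovalData s C v a w) (hij : #(C j) < #(C i)) (hi : #(C i) < #(C v))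
    (hb : b ∈ C j) (hh : h ≤ #(C j)) :
    w * layerProd K s C #(C v) a h * (1 - starSum K b (C i)) = 0 := by
  have hjv : j ≠ v := by rintro rfl; omega
  have hiv : i ≠ v := by rintro rfl; omega
  have hne : i ≠ j := by rintro rfl; omega
  have hb' : b ∈ eraseEntry C v a j := by rwa [eraseEntry_of_ne hjv]
  have hba : b ≠ a := (H.mem_eraseEntry.1 hb').2
  have h0 := H.mul_layerProd_mul_eq_zero_of_commute hne hiv hij.le hb' (h := #(C i) + 1) hi
    (fun k hk _ => by omega)
  rw [eraseEntry_of_ne hiv, mul_sub, mul_one, sub_eq_zero] at h0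
  have hy : ∀ k, k ≠ #(C j) → k < #(C i) →
      Commute (1 - starSum K b (C i)) (starSum K a (layer s C k)) := by
    intro k hk hki
    rw [← eraseEntry_of_ne (a := a) (C := C) hiv]
    exact H.commute_starSum_layer hb' (by omega)
  have hyu : Commute (1 - starSum K b (C i)) (starSum K a ((upper s C #(C j)).erase a)) := by
    rw [← eraseEntry_of_ne (a := a) (C := C) hiv]
    exact H.commute_starSum_upper hb' le_rfl hij.le
  refine H.mul_layerProd_mul_eq_zero_of_eq hb hij (Nat.le_succ _) hi hy
    (fun k hk => hy k (by omega)) hyu hyu (axialDist K s C #(C v) #(C i))⁻¹ ?_ hh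
  -- `W` satisfies the relation; the factor of the column `i` changes it by a multiple of
  -- `W (a, b) (1 - ∑ (b, d))`.
  set W := w * layerProd K s C #(C v) a (#(C i) + 1) with hW
  have h4 : W * starSum K a (layer s C #(C i)) * starSum K b (C i) =
      W * starSum K a (layer s C #(C i)) - W * transp K a b * starSum K b (C i) +
        W * transp K a b := by
    rw [mul_assoc W, H.starSum_layer_mul_starSum hne hiv hb hba hij.ne, mul_add, mul_sub, ← mul_assoc W,
      ← mul_assoc W, ← mul_assoc W, ← h0]
  rw [mul_layerProd_eq hi, ← hW, sub_mul, mul_sub, mul_one, ← h0, smul_mul_assoc, mul_sub, mul_one, h4,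
    mul_sub, mul_one, sub_self, zero_sub, ← smul_neg]
  congr 1
  abel

theorem antisymmetricOn_eraseEntry (H : RemovalData s C v a w) (hh : h ≤ #(C v)) (j : ι) :
    AntisymmetricOn (eraseEntry C v a j) (w * layerProd K s C #(C v) a h) := by
  intro b hb d hd hbd
  rw [H.mem_eraseEntry] at hb hd
  rw [mul_assoc, ← (commute_layerProd hh fun k _ _ =>
      H.family.commute_layer hb.1 hd.1 hb.2 hd.2 Iff.rfl).eq,
    ← mul_assoc, H.rel.antisymm j b hb.1 d hd.1 hbd, neg_mul]

/-- Multiplication by the factors of all the columns which are lower than the column of `a` turns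
the relations for the columns with `a` into the relations for the columns without `a`. -/
theorem columnRelations (H : RemovalData s C v a w) :
    ColumnRelations (eraseEntry C v a) (w * layerProd K s C #(C v) a 1) := by
  have hC := H.family
  have hp : 1 ≤ #(C v) := card_pos.2 ⟨a, H.mem⟩
  refine ⟨H.antisymmetricOn_eraseEntry hp, fun i j hij hcard b hb => ?_⟩
  have hbj := H.mem_eraseEntry.1 hb
  have hj1 : 1 ≤ #(C j) := card_pos.2 ⟨b, hbj.1⟩
  have hcv : #((C v).erase a) = #(C v) - 1 := card_erase_of_mem H.mem
  suffices hz : w * layerProd K s C #(C v) a 1 * (1 - starSum K b (eraseEntry C v a i)) = 0 by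
    rw [mul_sub, mul_one, sub_eq_zero] at hz
    exact hz.symm
  rcases eq_or_ne i v with rfl | hi
  · rw [eraseEntry_self, eraseEntry_of_ne hij.symm, hcv] at hcard
    rw [eraseEntry_self]
    exact H.exchange_erased (by omega) hbj.1 hj1
  rcases eq_or_ne j v with rfl | hj
  · -- A lower column `i` now has the same height as the shortened column `v`.
    rw [eraseEntry_self, eraseEntry_of_ne hi, hcv] at hcard
    rcases le_or_gt #(C j) #(C i) with hle | hgt
    · exact H.mul_layerProd_mul_eq_zero_of_commute hij hi hle hb hp fun k _ _ => by omega
    · rw [eraseEntry_self] at hb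
      have hA := H.antisymmetricOn_eraseEntry hp
      have hA1 := hA j
      have hA2 := hA i
      rw [eraseEntry_self] at hA1
      rw [eraseEntry_of_ne hi] at hA2 ⊢
      rw [mul_sub, mul_one, sub_eq_zero, eq_comm]
      refine mul_starSum_eq_self_of_card_eq hA1 hA2
        ((hC.disjoint hij.symm).mono_left (erase_subset _ _)) (by omega) (fun y hy => ?_) hb
      have h0 := H.exchange_erased hgt hy (h := 1) (card_pos.2 ⟨y, hy⟩)
      rw [mul_sub, mul_one, sub_eq_zero] at h0
      exact h0.symm
  rw [eraseEntry_of_ne hi, eraseEntry_of_ne hj] at hcard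
  rcases eq_or_lt_of_le hcard with heq | hlt
  · exact H.mul_layerProd_mul_eq_zero_of_commute hij hi hcard hb hp fun k _ _ => by omega
  rcases le_or_gt #(C v) #(C i) with hle | hgt
  · rcases le_or_gt #(C v) #(C j) with hle' | hgt'
    · exact H.mul_layerProd_mul_eq_zero_of_commute hij hi hcard hb hp fun k _ _ => by omega
    · refine H.mul_layerProd_mul_eq_zero_of_eq hbj.1 (z := 1) (Nat.lt_succ_self _) le_rfl hgt'
        (fun k hk hkj => H.commute_starSum_layer hb (by omega)) (fun _ _ _ => Commute.one_left _)
        (H.commute_starSum_upper hb le_rfl hcard) (Commute.one_left _) 0 ?_ hj1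
      rw [zero_smul]
      exact H.mul_layerProd_mul_eq_zero_of_commute hij hi hcard hb hgt' fun k _ _ => by omega
  · rw [eraseEntry_of_ne hi]
    exact H.exchange_lower hlt hgt hbj.1 hj1

end RemovalData

end Removal

/-! ### The sum over a column -/

section ColumnSum

variable {K A ι : Type*} [Field K] [DecidableEq A]
  {s : Finset ι} {C : ι → Finset A} {v j : ι} {a b d : A} {h t p : ℕ}
  {w : MonoidAlgebra K (Equiv.Perm A)}

/-- The scalar by which `layerProd K s C p b h` acts if `b` is an entry of a column of height less
than `h`. -/
noncomputable def layerWeight (K : Type*) [Field K] (s : Finset ι) (C : ι → Finset A) (p h : ℕ) : K :=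
  ∏ i ∈ Ico h p, (1 - (axialDist K s C p i)⁻¹ * #(s.filter fun j => #(C j) = i))

theorem axialDist_self : axialDist K s C p p = 0 := sub_self _

theorem axialDist_sub (s : Finset ι) (C : ι → Finset A) (p h : ℕ) :
    axialDist K s C p h - #(s.filter fun j => #(C j) = h) = axialDist K s C p (h + 1) + 1 := by
  classical
  have h1 : (s.filter fun j => h ≤ #(C j)) =
      (s.filter fun j => h + 1 ≤ #(C j)) ∪ s.filter fun j => #(C j) = h := by
    rw [← filter_or]; exact filter_congr fun j _ => by omega
  have h2 : #(s.filter fun j => h ≤ #(C j)) =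
      #(s.filter fun j => h + 1 ≤ #(C j)) + #(s.filter fun j => #(C j) = h) := by
    rw [h1, card_union_of_disjoint]
    exact disjoint_filter.2 fun j _ hj => by omega
  simp only [axialDist, contentGE, h2]
  push_cast
  ring

theorem layerWeight_eq_mul (hp : h < p) :
    layerWeight K s C p h = layerWeight K s C p (h + 1) *
      (1 - (axialDist K s C p h)⁻¹ * #(s.filter fun j => #(C j) = h)) := by
  rw [layerWeight, layerWeight, prod_eq_prod_Ico_succ_bot hp, mul_comm]

/-- As `r - l` for the height `h` is `r + 1` for the height `h + 1`, the product telescopes. -/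
theorem layerWeight_mul [CharZero K] (hp : h ≤ p) :
    layerWeight K s C p h * (axialDist K s C p h + 1) =
      ∏ i ∈ Ico h p, ((axialDist K s C p i + 1) / axialDist K s C p i) := by
  refine Nat.decreasingInduction' (P := fun k => layerWeight K s C p k * (axialDist K s C p k + 1) =
      ∏ i ∈ Ico k p, ((axialDist K s C p i + 1) / axialDist K s C p i)) (fun k hk _ ih => ?_) hp ?_
  · have hr := axialDist_ne_zero (K := K) (s := s) (C := C) hk
    rw [prod_eq_prod_Ico_succ_bot hk, ← ih, layerWeight_eq_mul hk, ← axialDist_sub s C p k]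
    field_simp
  · simp [layerWeight, axialDist_self]

theorem ColumnRelations.mul_layerProd (hw : ColumnRelations C w) (hC : IsColumnFamily s C)
    (hb : b ∈ C j) (hj : #(C j) < h) (hp : h ≤ p) :
    w * layerProd K s C p b h = layerWeight K s C p h • w := by
  refine Nat.decreasingInduction' (P := fun k => w * layerProd K s C p b k = layerWeight K s C p k • w)
    (fun k hk hhk ih => ?_) hp ?_
  · rw [mul_layerProd_eq hk, ih, smul_mul_assoc, hw.mul_starSum_layer hC hb (hj.trans_le hhk),
      layerWeight_eq_mul hk]
    module
  · simp [layerProd_self, layerWeight]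

theorem card_layer (hC : IsColumnFamily s C) (h : ℕ) :
    #(layer s C h) = #(s.filter fun j => #(C j) = h) * h := by
  rw [layer, card_biUnion fun i _ j _ hij => hC.disjoint hij, sum_const_nat]
  exact fun j hj => (mem_filter.1 hj).2

/-- The sum over the entries `d` of a column `v` of the products of factors for `d` is a scalar. -/
theorem ColumnRelations.sum_mul_layerProd [CharZero K] (hw : ColumnRelations C w)
    (hC : IsColumnFamily s C) (hh : h ≤ #(C v)) :
    ∑ d ∈ C v, w * layerProd K s C #(C v) d h =
      (layerWeight K s C #(C v) h * (axialDist K s C #(C v) h + h)) • w := by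
  refine Nat.decreasingInduction' (P := fun k => ∑ d ∈ C v, w * layerProd K s C #(C v) d k =
      (layerWeight K s C #(C v) k * (axialDist K s C #(C v) k + k)) • w) (fun k hk hhk ih => ?_) hh ?_
  · have hr := axialDist_ne_zero (K := K) (s := s) (C := C) hk
    have key : ∑ d ∈ C v, w * layerProd K s C #(C v) d (k + 1) * starSum K d (layer s C k) =
        (#(s.filter fun j => #(C j) = k) * k * layerWeight K s C #(C v) (k + 1) : K) • w := by
      simp_rw [mul_starSum _ _ (layer s C k)]
      rw [sum_comm]
      have h1 : ∀ b ∈ layer s C k, ∑ d ∈ C v, w * layerProd K s C #(C v) d (k + 1) * transp K d b =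
          layerWeight K s C #(C v) (k + 1) • w := by
        intro b hb
        obtain ⟨j, hj, hjk⟩ := IsColumnFamily.exists_of_mem_layer hb
        have h2 : ∀ d ∈ C v, w * layerProd K s C #(C v) d (k + 1) * transp K d b =
            w * transp K b d * layerProd K s C #(C v) b (k + 1) := by
          intro d hd
          rw [mul_assoc, mul_assoc, transp_comm d b]
          congr 1
          refine (transp_mul_layerProd hk fun i hi hiv => ?_).symm
          rw [hC.mem_layer hj, hC.mem_layer hd]; omega
        rw [sum_congr rfl h2, ← sum_mul, ← mul_starSum,
          hw.exchange v j (by rintro rfl; omega) (by omega) b hj,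
          hw.mul_layerProd hC hj (by omega) hk]
      rw [sum_congr rfl h1, sum_const, card_layer hC, ← Nat.cast_smul_eq_nsmul K, smul_smul]
      push_cast
      rfl
    simp_rw [mul_layerProd_eq hk]
    rw [sum_sub_distrib, ← smul_sum, key, ih, smul_smul, ← sub_smul, layerWeight_eq_mul hk]
    congr 1
    have h3 := axialDist_sub (K := K) s C #(C v) k
    push_cast
    rw [show axialDist K s C #(C v) (k + 1) = axialDist K s C #(C v) k -
      #(s.filter fun j => #(C j) = k) - 1 by rw [h3]; ring]
    field_simp
    ring
  · simp only [layerProd_self, mul_one, sum_const, axialDist_self, zero_add, layerWeight, Ico_self,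
      prod_empty, one_mul]
    rw [Nat.cast_smul_eq_nsmul]

end ColumnSum

/-! ### Sums over subgroups of permutations -/

section GroupSums

variable {K A : Type*} [Field K] [Fintype A] [DecidableEq A] {G H : Subgroup (Equiv.Perm A)}

open Classical in
/-- The sum of the elements of a subgroup. -/
noncomputable def symmetrizer (K : Type*) [Field K] (G : Subgroup (Equiv.Perm A)) :
    MonoidAlgebra K (Equiv.Perm A) :=
  ∑ σ : Equiv.Perm A with σ ∈ G, MonoidAlgebra.of K (Equiv.Perm A) σ

open Classical in
/-- The signed sum of the elements of a subgroup. -/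
noncomputable def antisymmetrizer (K : Type*) [Field K] (G : Subgroup (Equiv.Perm A)) :
    MonoidAlgebra K (Equiv.Perm A) :=
  ∑ τ : Equiv.Perm A with τ ∈ G,
    ((Equiv.Perm.sign τ : ℤ) : K) • MonoidAlgebra.of K (Equiv.Perm A) τ

theorem sign_mul_sign (σ : Equiv.Perm A) :
    ((Equiv.Perm.sign σ : ℤ) : K) * ((Equiv.Perm.sign σ : ℤ) : K) = 1 := by
  rw [← Int.cast_mul, ← Units.val_mul, Int.units_mul_self, Units.val_one, Int.cast_one]

theorem of_mul_symmetrizer {σ : Equiv.Perm A} (hσ : σ ∈ G) :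
    MonoidAlgebra.of K (Equiv.Perm A) σ * symmetrizer K G = symmetrizer K G := by
  classical
  rw [symmetrizer, mul_sum]
  refine sum_equiv (Equiv.mulLeft σ) (fun τ => ?_) fun τ _ => ?_
  · simp [G.mul_mem_cancel_left hσ]
  · rw [← map_mul]; rfl

theorem symmetrizer_mul_of {σ : Equiv.Perm A} (hσ : σ ∈ G) :
    symmetrizer K G * MonoidAlgebra.of K (Equiv.Perm A) σ = symmetrizer K G := by
  classical
  rw [symmetrizer, sum_mul]
  refine sum_equiv (Equiv.mulRight σ) (fun τ => ?_) fun τ _ => ?_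
  · simp [G.mul_mem_cancel_right hσ]
  · rw [← map_mul]; rfl

theorem of_mul_antisymmetrizer {σ : Equiv.Perm A} (hσ : σ ∈ G) :
    MonoidAlgebra.of K (Equiv.Perm A) σ * antisymmetrizer K G =
      ((Equiv.Perm.sign σ : ℤ) : K) • antisymmetrizer K G := by
  classical
  rw [antisymmetrizer, mul_sum, smul_sum]
  refine sum_equiv (Equiv.mulLeft σ) (fun τ => ?_) fun τ _ => ?_
  · simp [G.mul_mem_cancel_left hσ]
  · rw [Equiv.coe_mulLeft, map_mul, map_mul, mul_smul_comm, smul_smul, Units.val_mul, Int.cast_mul,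
      ← mul_assoc, sign_mul_sign, one_mul]

theorem antisymmetrizer_mul_of {σ : Equiv.Perm A} (hσ : σ ∈ G) :
    antisymmetrizer K G * MonoidAlgebra.of K (Equiv.Perm A) σ =
      ((Equiv.Perm.sign σ : ℤ) : K) • antisymmetrizer K G := by
  classical
  rw [antisymmetrizer, sum_mul, smul_sum]
  refine sum_equiv (Equiv.mulRight σ) (fun τ => ?_) fun τ _ => ?_
  · simp [G.mul_mem_cancel_right hσ]
  · rw [Equiv.coe_mulRight, map_mul, map_mul, smul_mul_assoc, smul_smul, Units.val_mul, Int.cast_mul,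
      mul_left_comm, sign_mul_sign, mul_one]

open Classical in
/-- A sum over a subgroup `G` as a sum over the cosets of the stabilizer `H` of `a` in `G`, if the
orbit `O` of `a` is such that `G` contains the transpositions of `a` with the elements of `O`. -/
theorem sum_subgroup_eq {M : Type*} [AddCommMonoid M] {a : A} {O : Finset A}
    (hO : ∀ e ∈ O, Equiv.swap a e ∈ G) (hG : ∀ σ ∈ G, σ a ∈ O)
    (hH : ∀ σ, σ ∈ H ↔ σ ∈ G ∧ σ a = a) (f : Equiv.Perm A → M) :
    ∑ σ : Equiv.Perm A with σ ∈ G, f σ =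
      ∑ e ∈ O, ∑ η : Equiv.Perm A with η ∈ H, f (η * Equiv.swap a e) := by
  rw [← sum_product']
  refine sum_nbij' (fun σ => (σ⁻¹ a, σ * Equiv.swap a (σ⁻¹ a))) (fun x => x.2 * Equiv.swap a x.1)
    ?_ ?_ ?_ ?_ ?_
  · intro σ hσ
    simp only [mem_filter, mem_univ, true_and, mem_product, hH] at hσ ⊢
    have h1 := hG _ (G.inv_mem hσ)
    exact ⟨h1, G.mul_mem hσ (hO _ h1), by simp⟩
  · rintro ⟨e, η⟩ hx
    simp only [mem_filter, mem_univ, true_and, mem_product, hH] at hx ⊢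
    exact G.mul_mem hx.2.1 (hO _ hx.1)
  · intro σ _
    simp [mul_assoc]
  · rintro ⟨e, η⟩ hx
    simp only [mem_filter, mem_univ, true_and, mem_product, hH] at hx
    have h1 : η⁻¹ a = a := by rw [Equiv.Perm.inv_eq_iff_eq]; exact hx.2.2.symm
    have h2 : (η * Equiv.swap a e)⁻¹ a = e := by
      rw [mul_inv_rev, Equiv.Perm.mul_apply, h1, Equiv.swap_inv, Equiv.swap_apply_left]
    refine Prod.ext h2 ?_
    change η * Equiv.swap a e * Equiv.swap a ((η * Equiv.swap a e)⁻¹ a) = η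
    rw [h2, mul_assoc, Equiv.swap_mul_self, mul_one]
  · intro σ _
    simp [mul_assoc]

theorem antisymmetrizer_eq_mul {a : A} {O : Finset A} (ha : a ∈ O)
    (hO : ∀ e ∈ O, Equiv.swap a e ∈ G) (hG : ∀ σ ∈ G, σ a ∈ O)
    (hH : ∀ σ, σ ∈ H ↔ σ ∈ G ∧ σ a = a) :
    antisymmetrizer K G = antisymmetrizer K H * (1 - starSum K a (O.erase a)) := by
  classical
  rw [antisymmetrizer, sum_subgroup_eq hO hG hH, ← add_sum_erase _ _ ha, mul_sub, mul_one,
    mul_starSum, sub_eq_add_neg, ← sum_neg_distrib]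
  congr 1
  · rw [antisymmetrizer]; simp [show (Equiv.refl A : Equiv.Perm A) = 1 from rfl]
  · refine sum_congr rfl fun e he => ?_
    rw [antisymmetrizer, sum_mul, ← sum_neg_distrib]
    refine sum_congr rfl fun η _ => ?_
    rw [map_mul, map_mul, Equiv.Perm.sign_swap (ne_of_mem_erase he).symm, smul_mul_assoc, transp]
    simp

theorem symmetrizer_eq_mul {a : A} {O : Finset A} (ha : a ∈ O)
    (hO : ∀ e ∈ O, Equiv.swap a e ∈ G) (hG : ∀ σ ∈ G, σ a ∈ O)
    (hH : ∀ σ, σ ∈ H ↔ σ ∈ G ∧ σ a = a) :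
    symmetrizer K G = (1 + starSum K a (O.erase a)) * symmetrizer K H := by
  classical
  have hinv : ∀ (L : Subgroup (Equiv.Perm A)) (f : Equiv.Perm A → MonoidAlgebra K (Equiv.Perm A)),
      ∑ σ : Equiv.Perm A with σ ∈ L, f σ = ∑ σ : Equiv.Perm A with σ ∈ L, f σ⁻¹ := by
    intro L f
    exact sum_equiv (Equiv.inv _) (fun σ => by simp) fun σ _ => by simp
  rw [symmetrizer, hinv, sum_subgroup_eq hO hG hH, ← add_sum_erase _ _ ha, add_mul, one_mul,
    starSum, sum_mul]
  congr 1
  · rw [symmetrizer, hinv]; simp [show (Equiv.refl A : Equiv.Perm A) = 1 from rfl]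
  · refine sum_congr rfl fun e he => ?_
    rw [symmetrizer, hinv, mul_sum]
    refine sum_congr rfl fun η _ => ?_
    rw [transp, ← map_mul, mul_inv_rev, Equiv.swap_inv, inv_inv]

/-- The permutations which fix the complement of `R` and preserve each of the sets `F i`. -/
def familySubgroup (R : Set A) (F : ℕ → Set A) : Subgroup (Equiv.Perm A) :=
  open scoped Pointwise in
  fixingSubgroup (Equiv.Perm A) Rᶜ ⊓ ⨅ i : ℕ, MulAction.stabilizer (Equiv.Perm A) (F i)

variable {R R' : Set A} {F F' : ℕ → Set A} {σ : Equiv.Perm A} {a x y : A} {i : ℕ}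

theorem mem_familySubgroup :
    σ ∈ familySubgroup R F ↔ (∀ x ∉ R, σ x = x) ∧ ∀ i, ∀ x ∈ F i, σ x ∈ F i := by
  simp only [familySubgroup, Subgroup.mem_inf, Subgroup.mem_iInf, mem_fixingSubgroup_iff,
    Set.mem_compl_iff, Equiv.Perm.smul_def]
  refine and_congr Iff.rfl (forall_congr' fun i => ?_)
  rw [MulAction.mem_stabilizer_set' (Set.toFinite _)]
  rfl

theorem swap_mem_familySubgroup (hF : ∀ i j x, x ∈ F i → x ∈ F j → i = j) (hR : ∀ i, F i ⊆ R)
    (hx : x ∈ F i) (hy : y ∈ F i) : Equiv.swap x y ∈ familySubgroup R F := by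
  rw [mem_familySubgroup]
  constructor
  · intro z hz
    refine Equiv.swap_apply_of_ne_of_ne ?_ ?_
    · rintro rfl; exact hz (hR i hx)
    · rintro rfl; exact hz (hR i hy)
  · intro j z hz
    rcases eq_or_ne z x with rfl | hzx
    · rw [Equiv.swap_apply_left, hF j i z hz hx]; exact hy
    rcases eq_or_ne z y with rfl | hzy
    · rw [Equiv.swap_apply_right, hF j i z hz hy]; exact hx
    rwa [Equiv.swap_apply_of_ne_of_ne hzx hzy]

theorem mem_familySubgroup_diff (hR : R' = R \ {a}) (hF : ∀ i, F' i = F i \ {a}) :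
    σ ∈ familySubgroup R' F' ↔ σ ∈ familySubgroup R F ∧ σ a = a := by
  subst hR
  obtain rfl : F' = fun i => F i \ {a} := funext hF
  rw [mem_familySubgroup, mem_familySubgroup]
  constructor
  · rintro ⟨h1, h2⟩
    have ha : σ a = a := h1 a fun h => h.2 rfl
    refine ⟨⟨fun x hx => h1 x fun h => hx h.1, fun i x hx => ?_⟩, ha⟩
    rcases eq_or_ne x a with rfl | hxa
    · rwa [ha]
    · exact (h2 i x ⟨hx, hxa⟩).1
  · rintro ⟨⟨h1, h2⟩, ha⟩
    refine ⟨fun x hx => ?_, fun i x hx => ⟨h2 i x hx.1, fun h => hx.2 ?_⟩⟩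
    · rcases eq_or_ne x a with rfl | hxa
      · exact ha
      · exact h1 x fun h => hx ⟨h, hxa⟩
    · exact σ.injective (h.trans ha.symm)

end GroupSums

/-! ### Young symmetrizers satisfy the column relations -/

section Tableaux

variable {K A : Type*} [Field K] [DecidableEq A] {ν : YoungDiagram}

namespace YoungTableau

/-- The set of entries of the `j`-th column, as a `Finset`. -/
def columnEntries (T : YoungTableau ν A) (j : ℕ) : Finset A :=
  (univ.filter fun c : {c : ℕ × ℕ // c ∈ ν.cells} => c.1.2 = j).image T

/-- The set of entries of the `i`-th row, as a `Finset`. -/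
def rowEntries (T : YoungTableau ν A) (i : ℕ) : Finset A :=
  (univ.filter fun c : {c : ℕ × ℕ // c ∈ ν.cells} => c.1.1 = i).image T

variable (T : YoungTableau ν A) {i j : ℕ} {x : A}

theorem mem_columnEntries : x ∈ T.columnEntries j ↔ ∃ i, ∃ h : (i, j) ∈ ν.cells, T ⟨(i, j), h⟩ = x := by
  simp only [columnEntries, mem_image, mem_filter, mem_univ, true_and]
  constructor
  · rintro ⟨⟨⟨i, k⟩, hc⟩, rfl, rfl⟩
    exact ⟨i, hc, rfl⟩
  · rintro ⟨i, hc, rfl⟩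
    exact ⟨⟨(i, j), hc⟩, rfl, rfl⟩

theorem mem_rowEntries : x ∈ T.rowEntries i ↔ ∃ j, ∃ h : (i, j) ∈ ν.cells, T ⟨(i, j), h⟩ = x := by
  simp only [rowEntries, mem_image, mem_filter, mem_univ, true_and]
  constructor
  · rintro ⟨⟨⟨i, k⟩, hc⟩, rfl, rfl⟩
    exact ⟨k, hc, rfl⟩
  · rintro ⟨j, hc, rfl⟩
    exact ⟨⟨(i, j), hc⟩, rfl, rfl⟩

theorem coe_columnEntries : (T.columnEntries j : Set A) = T.column j := by
  ext x
  simp [columnEntries, column]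

theorem coe_rowEntries : (T.rowEntries i : Set A) = T.row i := by
  ext x
  simp [rowEntries, row]

theorem card_columnEntries : #(T.columnEntries j) = ν.colLen j := by
  rw [columnEntries, card_image_of_injective _ T.injective, YoungDiagram.colLen_eq_card,
    YoungDiagram.col]
  refine card_bij (fun c _ => c.1) (fun c hc => ?_) (fun c _ d _ h => Subtype.ext h) fun c hc => ?_
  · simp only [mem_filter, mem_univ, true_and] at hc ⊢
    exact ⟨c.2, hc⟩
  · simp only [mem_filter] at hc
    exact ⟨⟨c, hc.1⟩, by simp [hc.2], rfl⟩

theorem column_unique {j j' : ℕ} (h : x ∈ T.column j) (h' : x ∈ T.column j') : j = j' := by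
  obtain ⟨c, rfl, rfl⟩ := h
  obtain ⟨d, rfl, hd⟩ := h'
  rw [T.injective hd]

theorem row_unique {i i' : ℕ} (h : x ∈ T.row i) (h' : x ∈ T.row i') : i = i' := by
  obtain ⟨c, rfl, rfl⟩ := h
  obtain ⟨d, rfl, hd⟩ := h'
  rw [T.injective hd]

theorem column_subset_range : T.column j ⊆ Set.range T := by
  rintro _ ⟨c, -, rfl⟩; exact ⟨c, rfl⟩

theorem row_subset_range : T.row i ⊆ Set.range T := by
  rintro _ ⟨c, -, rfl⟩; exact ⟨c, rfl⟩

theorem isColumnFamily {n : ℕ} (hn : ν.rowLen 0 ≤ n) : IsColumnFamily (range n) T.columnEntries where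
  disjoint i j hij := by
    refine disjoint_left.2 fun x hx hx' => ?_
    rw [← mem_coe, coe_columnEntries] at hx hx'
    exact hij (T.column_unique hx hx')
  eq_empty j hj := by
    rw [mem_range, not_lt] at hj
    rw [eq_empty_iff_forall_notMem]
    intro x hx
    obtain ⟨i, h, -⟩ := T.mem_columnEntries.1 hx
    have h0 := ν.up_left_mem (Nat.zero_le i) le_rfl h
    rw [YoungDiagram.mem_iff_lt_rowLen] at h0
    omega

variable [Fintype A]

theorem rowSubgroup_eq : T.rowSubgroup = familySubgroup (Set.range T) T.row := rfl

theorem columnSubgroup_eq : T.columnSubgroup = familySubgroup (Set.range T) T.column := rfl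

theorem youngSymmetrizer_eq :
    T.youngSymmetrizer K = symmetrizer K T.rowSubgroup * antisymmetrizer K T.columnSubgroup := rfl

theorem swap_mem_rowSubgroup {y : A} (hx : x ∈ T.row i) (hy : y ∈ T.row i) :
    Equiv.swap x y ∈ T.rowSubgroup :=
  swap_mem_familySubgroup (fun _ _ _ => T.row_unique) (fun _ => T.row_subset_range) hx hy

theorem swap_mem_columnSubgroup {y : A} (hx : x ∈ T.column j) (hy : y ∈ T.column j) :
    Equiv.swap x y ∈ T.columnSubgroup :=
  swap_mem_familySubgroup (fun _ _ _ => T.column_unique) (fun _ => T.column_subset_range) hx hy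

theorem apply_mem_column {σ : Equiv.Perm A} (hσ : σ ∈ T.columnSubgroup) (hx : x ∈ T.column j) :
    σ x ∈ T.column j := by
  rw [columnSubgroup_eq, mem_familySubgroup] at hσ
  exact hσ.2 j x hx

theorem apply_mem_row {σ : Equiv.Perm A} (hσ : σ ∈ T.rowSubgroup) (hx : x ∈ T.row i) :
    σ x ∈ T.row i := by
  rw [rowSubgroup_eq, mem_familySubgroup] at hσ
  exact hσ.2 i x hx

variable [CharZero K]

/-- If `U` has more entries than there are rows that meet it, the Young symmetrizer is killed by the
antisymmetrizer of `U`: any column permutation leaves two entries of `U` in a common row. -/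
theorem youngSymmetrizer_mul_antisymmetrizer {U : Finset A} {m : ℕ} (hm : m < #U)
    (hU : ∀ x ∈ U, ∃ j, x ∈ T.column j ∧ ν.colLen j ≤ m) :
    T.youngSymmetrizer K * antisymmetrizer K (fixingSubgroup (Equiv.Perm A) (U : Set A)ᶜ) = 0 := by
  classical
  set N := antisymmetrizer K (fixingSubgroup (Equiv.Perm A) (U : Set A)ᶜ) with hN
  rw [youngSymmetrizer_eq, antisymmetrizer, mul_sum, sum_mul]
  refine sum_eq_zero fun τ hτ => ?_
  rw [mem_filter] at hτ
  have hrow : ∀ x ∈ U, ∃ i ∈ range m, τ x ∈ T.row i := by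
    intro x hx
    obtain ⟨j, hj, hjm⟩ := hU x hx
    obtain ⟨c, hcj, hc⟩ := T.apply_mem_column hτ.2 hj
    refine ⟨c.1.1, mem_range.2 (lt_of_lt_of_le ?_ hjm), c, rfl, hc⟩
    rw [← hcj, ← YoungDiagram.mem_iff_lt_colLen]
    exact c.2
  choose! r hr hrr using hrow
  obtain ⟨x, hx, y, hy, hxy, hxy'⟩ := exists_ne_map_eq_of_card_lt_of_maps_to (t := range m)
    (by rwa [card_range]) hr
  have h1 : symmetrizer K T.rowSubgroup * transp K (τ x) (τ y) = symmetrizer K T.rowSubgroup :=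
    symmetrizer_mul_of (T.swap_mem_rowSubgroup (hrr x hx) (hxy' ▸ hrr y hy))
  have h2 : transp K x y * N = -N := by
    rw [transp, hN, of_mul_antisymmetrizer, Equiv.Perm.sign_swap hxy]
    · simp
    · rw [mem_fixingSubgroup_iff]
      intro z hz
      refine Equiv.swap_apply_of_ne_of_ne ?_ ?_
      · rintro rfl; exact hz hx
      · rintro rfl; exact hz hy
  have h3 : symmetrizer K T.rowSubgroup * MonoidAlgebra.of K (Equiv.Perm A) τ * N =
      -(symmetrizer K T.rowSubgroup * MonoidAlgebra.of K (Equiv.Perm A) τ * N) := by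
    conv_lhs => rw [← h1, mul_assoc _ (transp K (τ x) (τ y)), ← of_mul_transp, ← mul_assoc,
      mul_assoc _ _ N, h2, mul_neg]
  have h4 : symmetrizer K T.rowSubgroup * MonoidAlgebra.of K (Equiv.Perm A) τ * N = 0 := by
    have h5 := add_eq_zero_iff_eq_neg.2 h3
    rw [← two_smul K] at h5
    exact (smul_eq_zero.1 h5).resolve_left two_ne_zero
  rw [mul_smul_comm, smul_mul_assoc, h4, smul_zero]

theorem youngSymmetrizer_mul_of {σ : Equiv.Perm A} (hσ : σ ∈ T.columnSubgroup) :
    T.youngSymmetrizer K * MonoidAlgebra.of K (Equiv.Perm A) σ =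
      ((Equiv.Perm.sign σ : ℤ) : K) • T.youngSymmetrizer K := by
  rw [youngSymmetrizer_eq, mul_assoc, antisymmetrizer_mul_of hσ, mul_smul_comm]

theorem columnRelations_youngSymmetrizer :
    ColumnRelations T.columnEntries (T.youngSymmetrizer K) where
  antisymm j b hb d hd hbd := by
    rw [← mem_coe, coe_columnEntries] at hb hd
    rw [transp, T.youngSymmetrizer_mul_of (T.swap_mem_columnSubgroup hb hd),
      Equiv.Perm.sign_swap hbd]
    simp
  exchange i j hij hcard b hb := by
    classical
    rw [card_columnEntries, card_columnEntries] at hcard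
    have hbi : b ∉ T.columnEntries i := fun h =>
      disjoint_left.1 ((T.isColumnFamily le_rfl).disjoint hij) h hb
    -- The antisymmetrizer of the column `i` and `b` is the one of the column times
    -- `1 - ∑ (b, d)`; it kills the Young symmetrizer, on which the one of the column is a scalar.
    set H := fixingSubgroup (Equiv.Perm A) (T.columnEntries i : Set A)ᶜ with hH
    have h1 := T.youngSymmetrizer_mul_antisymmetrizer (K := K)
      (U := insert b (T.columnEntries i)) (m := ν.colLen i)
      (by rw [card_insert_of_notMem hbi, card_columnEntries]; omega) (fun x hx => by
        rcases mem_insert.1 hx with rfl | hx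
        · exact ⟨j, by rwa [← coe_columnEntries], hcard⟩
        · exact ⟨i, by rwa [← coe_columnEntries], le_rfl⟩)
    have h2 := antisymmetrizer_eq_mul (K := K) (H := H)
      (G := fixingSubgroup (Equiv.Perm A) ((insert b (T.columnEntries i) : Finset A) : Set A)ᶜ)
      (mem_insert_self b (T.columnEntries i)) (fun e he => by
        rw [mem_fixingSubgroup_iff]
        intro z hz
        refine Equiv.swap_apply_of_ne_of_ne ?_ ?_
        · rintro rfl; exact hz (mem_insert_self _ _)
        · rintro rfl; exact hz he) (fun σ hσ => by
        rw [mem_fixingSubgroup_iff] at hσ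
        by_contra hb'
        have h3 := hσ (σ b) hb'
        rw [Equiv.Perm.smul_def, EmbeddingLike.apply_eq_iff_eq] at h3
        rw [h3] at hb'
        exact hb' (mem_insert_self _ _)) (fun σ => by
        rw [hH, mem_fixingSubgroup_iff, mem_fixingSubgroup_iff]
        simp only [Set.mem_compl_iff, mem_coe, mem_insert, Equiv.Perm.smul_def]
        constructor
        · exact fun h => ⟨fun y hy => h y fun hy' => hy (Or.inr hy'), h b hbi⟩
        · rintro ⟨h, hb'⟩ y hy
          by_cases hyb : y = b
          · rw [hyb, hb']
          · exact h y (by tauto))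
    have h3 : T.youngSymmetrizer K * antisymmetrizer K H =
        (#(univ.filter fun τ => τ ∈ H) : K) • T.youngSymmetrizer K := by
      rw [antisymmetrizer, mul_sum, Nat.cast_smul_eq_nsmul, ← sum_const]
      refine sum_congr rfl fun τ hτ => ?_
      rw [mem_filter] at hτ
      have hτH := hτ.2
      rw [hH, mem_fixingSubgroup_iff] at hτH
      have hmem : ∀ z ∈ T.column i, τ z ∈ T.column i := by
        intro z hz
        by_contra hz'
        rw [← coe_columnEntries] at hz'
        have h4 := hτH (τ z) hz'
        rw [Equiv.Perm.smul_def, EmbeddingLike.apply_eq_iff_eq] at h4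
        rw [h4, coe_columnEntries] at hz'
        exact hz' hz
      rw [mul_smul_comm, T.youngSymmetrizer_mul_of, smul_smul, sign_mul_sign, one_smul]
      rw [columnSubgroup_eq, mem_familySubgroup]
      refine ⟨fun z hz => hτH z fun hz' => hz ?_, fun k z hz => ?_⟩
      · rw [coe_columnEntries] at hz'
        exact T.column_subset_range hz'
      · rcases eq_or_ne k i with rfl | hk
        · exact hmem z hz
        · have : τ z = z := hτH z fun hz' => hk (by
            rw [coe_columnEntries] at hz'
            exact T.column_unique hz hz')
          rwa [this]
    have hne : (#(univ.filter fun τ => τ ∈ H) : K) ≠ 0 :=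
      Nat.cast_ne_zero.2 (card_pos.2 ⟨1, by simp [H.one_mem]⟩).ne'
    rw [h2, ← mul_assoc, h3, smul_mul_assoc, smul_eq_zero, or_iff_right hne, mul_sub, mul_one,
      erase_insert hbi, sub_eq_zero] at h1
    exact h1.symm

end YoungTableau

end Tableaux

/-! ### Hooks and corners -/

namespace YoungDiagram

theorem hookLength_add {ν : YoungDiagram} {i j : ℕ} (h : (i, j) ∈ ν.cells) :
    ν.hookLength (i, j) + i + j + 1 = ν.rowLen i + ν.colLen j := by
  have hr : j < ν.rowLen i := mem_iff_lt_rowLen.1 h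
  have hc : i < ν.colLen j := mem_iff_lt_colLen.1 h
  have heq : ν.hook (i, j) = ({i} ×ˢ Ico j (ν.rowLen i)) ∪ (Ico (i + 1) (ν.colLen j) ×ˢ {j}) := by
    ext ⟨x, y⟩
    simp only [hook, mem_filter, mem_union, mem_product, mem_singleton, mem_Ico]
    constructor
    · rintro ⟨hxy, ⟨rfl, hy⟩ | ⟨rfl, hx⟩⟩
      · exact Or.inl ⟨rfl, hy, mem_iff_lt_rowLen.1 hxy⟩
      · rcases eq_or_lt_of_le hx with rfl | hx
        · exact Or.inl ⟨rfl, le_rfl, mem_iff_lt_rowLen.1 hxy⟩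
        · exact Or.inr ⟨⟨hx, mem_iff_lt_colLen.1 hxy⟩, rfl⟩
    · rintro (⟨rfl, hy, hy'⟩ | ⟨⟨hx, hx'⟩, rfl⟩)
      · exact ⟨mem_iff_lt_rowLen.2 hy', Or.inl ⟨rfl, hy⟩⟩
      · exact ⟨mem_iff_lt_colLen.2 hx', Or.inr ⟨rfl, by omega⟩⟩
  have hdisj : Disjoint ({i} ×ˢ Ico j (ν.rowLen i)) (Ico (i + 1) (ν.colLen j) ×ˢ {j}) := by
    rw [disjoint_left]
    rintro ⟨x, y⟩ h1 h2
    simp only [mem_product, mem_singleton, mem_Ico] at h1 h2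
    omega
  rw [hookLength, heq, card_union_of_disjoint hdisj, card_product, card_product, card_singleton,
    card_singleton, Nat.card_Ico, Nat.card_Ico]
  omega

theorem hookLength_pos {ν : YoungDiagram} {c : ℕ × ℕ} (h : c ∈ ν.cells) : 0 < ν.hookLength c :=
  card_pos.2 ⟨c, mem_filter.2 ⟨h, Or.inl ⟨rfl, le_rfl⟩⟩⟩

theorem card_filter_colLen {ν : YoungDiagram} {n : ℕ} (hn : ν.rowLen 0 ≤ n) (h : ℕ) :
    #((range n).filter fun j => h + 1 ≤ ν.colLen j) = ν.rowLen h := by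
  rw [← card_range (ν.rowLen h)]
  congr 1
  ext j
  rw [mem_filter, mem_range, mem_range, Nat.succ_le_iff, ← mem_iff_lt_colLen, mem_iff_lt_rowLen]
  have := ν.rowLen_anti 0 h (Nat.zero_le h)
  omega

/-- The diagram `mu` is obtained from `lam` by removing the cell `(u, v)`. -/
structure IsRemoval (lam mu : YoungDiagram) (u v : ℕ) : Prop where
  mem : (u, v) ∈ lam.cells
  cells_eq : mu.cells = lam.cells.erase (u, v)

namespace IsRemoval

variable {lam mu : YoungDiagram} {u v i j : ℕ}

theorem mem_iff (h : IsRemoval lam mu u v) {c : ℕ × ℕ} : c ∈ mu ↔ c ≠ (u, v) ∧ c ∈ lam := by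
  rw [← mem_cells, h.cells_eq, mem_erase, mem_cells]

theorem le (h : IsRemoval lam mu u v) : mu ≤ lam := fun _ hc => (h.mem_iff.1 hc).2

theorem rowLen_self (h : IsRemoval lam mu u v) : lam.rowLen u = v + 1 := by
  refine le_antisymm ?_ (mem_iff_lt_rowLen.1 h.mem)
  by_contra! hlt
  have h1 : (u, v + 1) ∈ mu := h.mem_iff.2 ⟨by simp, mem_iff_lt_rowLen.2 hlt⟩
  exact (h.mem_iff.1 (mu.up_left_mem le_rfl (Nat.le_succ v) h1)).1 rfl

theorem colLen_self (h : IsRemoval lam mu u v) : lam.colLen v = u + 1 := by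
  refine le_antisymm ?_ (mem_iff_lt_colLen.1 h.mem)
  by_contra! hlt
  have h1 : (u + 1, v) ∈ mu := h.mem_iff.2 ⟨by simp, mem_iff_lt_colLen.2 hlt⟩
  exact (h.mem_iff.1 (mu.up_left_mem (Nat.le_succ u) le_rfl h1)).1 rfl

theorem rowLen_add (h : IsRemoval lam mu u v) (i : ℕ) :
    mu.rowLen i + (if i = u then 1 else 0) = lam.rowLen i := by
  have key : mu.rowLen i = lam.rowLen i - (if i = u then 1 else 0) := by
    refine eq_of_forall_lt_iff fun j => ?_
    rw [← mem_iff_lt_rowLen, h.mem_iff, mem_iff_lt_rowLen, Ne, Prod.mk.injEq]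
    have := h.rowLen_self
    split_ifs with hi
    · subst hi; omega
    · simp [hi]
  have := h.rowLen_self
  split_ifs at key ⊢ with hi
  · subst hi; omega
  · omega

theorem colLen_add (h : IsRemoval lam mu u v) (j : ℕ) :
    mu.colLen j + (if j = v then 1 else 0) = lam.colLen j := by
  have key : mu.colLen j = lam.colLen j - (if j = v then 1 else 0) := by
    refine eq_of_forall_lt_iff fun i => ?_
    rw [← mem_iff_lt_colLen, h.mem_iff, mem_iff_lt_colLen, Ne, Prod.mk.injEq]
    have := h.colLen_self
    split_ifs with hj
    · subst hj; omega
    · simp [hj]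
  have := h.colLen_self
  split_ifs at key ⊢ with hj
  · subst hj; omega
  · omega

theorem hookLength_eq_add (h : IsRemoval lam mu u v) (hc : (i, j) ∈ mu.cells) :
    lam.hookLength (i, j) =
      mu.hookLength (i, j) + (if i = u then 1 else 0) + (if j = v then 1 else 0) := by
  have h1 := hookLength_add hc
  have h2 := hookLength_add (h.le hc)
  have h3 := h.rowLen_add i
  have h4 := h.colLen_add j
  omega

/-- The effect on the product of the hook lengths of adding the cell `(u, v)`: the hooks centered in
the row or in the column of the new cell become longer by one. -/
theorem hookProduct_eq (K : Type*) [Field K] [CharZero K] (h : IsRemoval lam mu u v) :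
    (lam.hookProduct : K) = mu.hookProduct *
      (∏ j ∈ range v, ((mu.hookLength (u, j) : K) + 1) / mu.hookLength (u, j)) *
      ∏ i ∈ range u, ((mu.hookLength (i, v) : K) + 1) / mu.hookLength (i, v) := by
  have h1 : lam.hookLength (u, v) = 1 := by
    have := hookLength_add h.mem
    rw [h.rowLen_self, h.colLen_self] at this
    omega
  have h2 : lam.hookProduct = ∏ c ∈ mu.cells, lam.hookLength c := by
    rw [hookProduct, ← mul_prod_erase _ _ h.mem, h1, one_mul, h.cells_eq]
  have h3 : ∀ c ∈ mu.cells, (lam.hookLength c : K) = mu.hookLength c *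
      (if c.1 = u then ((mu.hookLength c : K) + 1) / mu.hookLength c else 1) *
      (if c.2 = v then ((mu.hookLength c : K) + 1) / mu.hookLength c else 1) := by
    rintro ⟨i, j⟩ hc
    have h0 : (mu.hookLength (i, j) : K) ≠ 0 := Nat.cast_ne_zero.2 (hookLength_pos hc).ne'
    rw [h.hookLength_eq_add hc]
    dsimp only
    split_ifs with hi hj hj
    · subst hi hj
      exact absurd rfl (h.mem_iff.1 hc).1
    · push_cast; field_simp; ring
    · push_cast; field_simp; ring
    · push_cast; ring
  rw [h2, Nat.cast_prod, prod_congr rfl h3, prod_mul_distrib, prod_mul_distrib, hookProduct,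
    Nat.cast_prod, ← prod_filter, ← prod_filter]
  have h5 : mu.cells.filter (fun c => c.1 = u) = {u} ×ˢ range v := by
    have hv := h.rowLen_add u
    rw [if_pos rfl, h.rowLen_self] at hv
    rw [show v = mu.rowLen u by omega, ← row_eq_prod]
    rfl
  have h6 : mu.cells.filter (fun c => c.2 = v) = range u ×ˢ {v} := by
    have hu := h.colLen_add v
    rw [if_pos rfl, h.colLen_self] at hu
    rw [show u = mu.colLen v by omega, ← col_eq_prod]
    rfl
  rw [h5, h6, prod_product, prod_singleton, prod_product]
  simp_rw [prod_singleton]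

end IsRemoval

/-- A nonempty diagram has a corner in its last row. -/
theorem exists_isRemoval_last {lam : YoungDiagram} (h : 0 < lam.card) :
    ∃ mu u v, IsRemoval lam mu u v ∧ lam.colLen 0 = u + 1 := by
  obtain ⟨⟨i, j⟩, hij⟩ := card_pos.1 h
  have h0 : 0 < lam.colLen 0 :=
    (Nat.zero_le i).trans_lt (mem_iff_lt_colLen.1 (lam.up_left_mem le_rfl (Nat.zero_le j) hij))
  obtain ⟨u, hu⟩ := Nat.exists_eq_succ_of_ne_zero h0.ne'
  have hu0 : 0 < lam.rowLen u := mem_iff_lt_rowLen.1 (mem_iff_lt_colLen.2 (by omega))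
  obtain ⟨v, hv⟩ := Nat.exists_eq_succ_of_ne_zero hu0.ne'
  have hmem : (u, v) ∈ lam.cells := mem_iff_lt_rowLen.2 (by omega)
  refine ⟨⟨lam.cells.erase (u, v), ?_⟩, u, v, ⟨hmem, rfl⟩, hu⟩
  rintro ⟨x, y⟩ ⟨x', y'⟩ hle hmem
  obtain ⟨hx, hy⟩ : x' ≤ x ∧ y' ≤ y := hle
  simp only [coe_erase, Set.mem_sdiff, mem_coe, Set.mem_singleton_iff, Prod.mk.injEq] at hmem ⊢
  refine ⟨lam.up_left_mem hx hy hmem.1, ?_⟩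
  rintro ⟨rfl, rfl⟩
  have h1 : x < lam.colLen 0 := mem_iff_lt_colLen.1 (lam.up_left_mem le_rfl (Nat.zero_le y) hmem.1)
  obtain rfl : x = x' := by omega
  have h2 : y < lam.rowLen x := mem_iff_lt_rowLen.1 hmem.1
  exact hmem.2 ⟨rfl, by omega⟩

end YoungDiagram

/-! ### Young symmetrizers on elements satisfying the column relations -/

section Main

variable {K A : Type*} [Field K] [DecidableEq A] {lam mu : YoungDiagram} {u v i j : ℕ}

open YoungDiagram

namespace YoungTableau

variable (T : YoungTableau lam A)

theorem contentGE_columnEntries {n : ℕ} (hn : lam.rowLen 0 ≤ n) (h : ℕ) :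
    contentGE K (range n) T.columnEntries (h + 1) = lam.rowLen h - (h + 1 : ℕ) := by
  rw [contentGE]
  simp_rw [card_columnEntries]
  rw [card_filter_colLen hn]

theorem axialDist_columnEntries {n : ℕ} (hn : lam.rowLen 0 ≤ n) (h : IsRemoval lam mu u v)
    (hi : i < u) :
    axialDist K (range n) T.columnEntries (u + 1) (i + 1) = mu.hookLength (i, v) := by
  have hmem : (i, v) ∈ mu.cells :=
    h.mem_iff.2 ⟨by simp; omega, lam.up_left_mem hi.le le_rfl h.mem⟩
  have h1 := hookLength_add hmem
  have h2 := h.rowLen_add i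
  have h3 := h.colLen_add v
  rw [if_neg hi.ne] at h2
  rw [if_pos rfl, h.colLen_self] at h3
  have h4 : mu.hookLength (i, v) + i + v + 1 = lam.rowLen i + u := by omega
  have h5 := congrArg (Nat.cast : ℕ → K) h4
  push_cast at h5
  rw [axialDist, T.contentGE_columnEntries hn, T.contentGE_columnEntries hn, h.rowLen_self]
  push_cast
  linear_combination -h5

variable {T}

theorem columnEntries_subtableau (h : IsRemoval lam mu u v) :
    (T.subtableau h.le).columnEntries = eraseEntry T.columnEntries v (T ⟨(u, v), h.mem⟩) := by
  funext j
  have key : ∀ x, x ∈ (T.subtableau h.le).columnEntries j ↔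
      x ∈ T.columnEntries j ∧ x ≠ T ⟨(u, v), h.mem⟩ := by
    intro x
    rw [mem_columnEntries, mem_columnEntries]
    constructor
    · rintro ⟨i, hi, rfl⟩
      refine ⟨⟨i, h.le hi, rfl⟩, fun heq => ?_⟩
      exact (h.mem_iff.1 hi).1 (congrArg Subtype.val (T.injective heq))
    · rintro ⟨⟨i, hi, rfl⟩, hne⟩
      exact ⟨i, h.mem_iff.2 ⟨fun heq => hne (congrArg T (Subtype.ext heq)), hi⟩, rfl⟩
  ext x
  rw [key]
  rcases eq_or_ne j v with rfl | hj
  · rw [eraseEntry_self, mem_erase, and_comm]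
  · rw [eraseEntry_of_ne hj, and_iff_left_iff_imp]
    rintro hx rfl
    obtain ⟨i, hi, heq⟩ := T.mem_columnEntries.1 hx
    exact hj (congrArg (fun c => c.1.2) (T.injective heq))

theorem range_subtableau (h : IsRemoval lam mu u v) :
    Set.range (T.subtableau h.le) = Set.range T \ {T ⟨(u, v), h.mem⟩} := by
  ext x
  simp only [Set.mem_range, Set.mem_sdiff, Set.mem_singleton_iff]
  constructor
  · rintro ⟨c, rfl⟩
    exact ⟨⟨_, rfl⟩, fun heq => (h.mem_iff.1 c.2).1 (congrArg Subtype.val (T.injective heq))⟩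
  · rintro ⟨⟨c, rfl⟩, hne⟩
    exact ⟨⟨c.1, h.mem_iff.2 ⟨fun heq => hne (congrArg T (Subtype.ext heq)), c.2⟩⟩, rfl⟩

theorem row_subtableau (h : IsRemoval lam mu u v) (i : ℕ) :
    (T.subtableau h.le).row i = T.row i \ {T ⟨(u, v), h.mem⟩} := by
  ext x
  simp only [row, Set.mem_ofPred_eq, Set.mem_sdiff, Set.mem_singleton_iff]
  constructor
  · rintro ⟨c, hc, rfl⟩
    exact ⟨⟨⟨c.1, h.le c.2⟩, hc, rfl⟩,
      fun heq => (h.mem_iff.1 c.2).1 (congrArg Subtype.val (T.injective heq))⟩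
  · rintro ⟨⟨c, hc, rfl⟩, hne⟩
    exact ⟨⟨c.1, h.mem_iff.2 ⟨fun heq => hne (congrArg T (Subtype.ext heq)), c.2⟩⟩, hc, rfl⟩

theorem column_subtableau (h : IsRemoval lam mu u v) (j : ℕ) :
    (T.subtableau h.le).column j = T.column j \ {T ⟨(u, v), h.mem⟩} := by
  ext x
  simp only [column, Set.mem_ofPred_eq, Set.mem_sdiff, Set.mem_singleton_iff]
  constructor
  · rintro ⟨c, hc, rfl⟩
    exact ⟨⟨⟨c.1, h.le c.2⟩, hc, rfl⟩,
      fun heq => (h.mem_iff.1 c.2).1 (congrArg Subtype.val (T.injective heq))⟩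
  · rintro ⟨⟨c, hc, rfl⟩, hne⟩
    exact ⟨⟨c.1, h.mem_iff.2 ⟨fun heq => hne (congrArg T (Subtype.ext heq)), c.2⟩⟩, hc, rfl⟩

theorem removalData (h : IsRemoval lam mu u v) {w : MonoidAlgebra K (Equiv.Perm A)}
    (hw : ColumnRelations T.columnEntries w) :
    RemovalData (range (lam.rowLen 0)) T.columnEntries v (T ⟨(u, v), h.mem⟩) w :=
  ⟨T.isColumnFamily le_rfl, hw, T.mem_columnEntries.2 ⟨u, h.mem, rfl⟩⟩

variable [Fintype A]

theorem symmetrizer_rowSubgroup (h : IsRemoval lam mu u v) :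
    symmetrizer K T.rowSubgroup =
      (1 + starSum K (T ⟨(u, v), h.mem⟩) ((T.rowEntries u).erase (T ⟨(u, v), h.mem⟩))) *
        symmetrizer K (T.subtableau h.le).rowSubgroup := by
  have hmem : T ⟨(u, v), h.mem⟩ ∈ T.row u := ⟨⟨(u, v), h.mem⟩, rfl, rfl⟩
  refine symmetrizer_eq_mul (T.mem_rowEntries.2 ⟨v, h.mem, rfl⟩) (fun e he => ?_) (fun σ hσ => ?_)
    fun σ => mem_familySubgroup_diff (range_subtableau h) (row_subtableau h)
  · rw [← mem_coe, coe_rowEntries] at he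
    exact T.swap_mem_rowSubgroup hmem he
  · rw [← mem_coe, coe_rowEntries]
    exact T.apply_mem_row hσ hmem

theorem antisymmetrizer_columnSubgroup (h : IsRemoval lam mu u v) :
    antisymmetrizer K T.columnSubgroup = antisymmetrizer K (T.subtableau h.le).columnSubgroup *
      (1 - starSum K (T ⟨(u, v), h.mem⟩) ((T.columnEntries v).erase (T ⟨(u, v), h.mem⟩))) := by
  have hmem : T ⟨(u, v), h.mem⟩ ∈ T.column v := ⟨⟨(u, v), h.mem⟩, rfl, rfl⟩
  refine antisymmetrizer_eq_mul (T.mem_columnEntries.2 ⟨u, h.mem, rfl⟩) (fun e he => ?_)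
    (fun σ hσ => ?_) fun σ => mem_familySubgroup_diff (range_subtableau h) (column_subtableau h)
  · rw [← mem_coe, coe_columnEntries] at he
    exact T.swap_mem_columnSubgroup hmem he
  · rw [← mem_coe, coe_columnEntries]
    exact T.apply_mem_column hσ hmem

variable [CharZero K] {w : MonoidAlgebra K (Equiv.Perm A)}

/-- After the exchange of `a` with an entry `b` in a row above it, the row symmetrizer of `S` kills
`w`, because `a` shares its column with the entry `d` which is in the row of `b`. -/
theorem mul_transp_mul_symmetrizer (h : IsRemoval lam mu u v)
    (hw : ColumnRelations T.columnEntries w) (hij : (i, j) ∈ lam.cells) (hi : i < u) (hj : j ≠ v)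
    {y : MonoidAlgebra K (Equiv.Perm A)}
    (hy : Commute (transp K (T ⟨(i, j), hij⟩) (T ⟨(i, v), lam.up_left_mem hi.le le_rfl h.mem⟩)) y) :
    w * transp K (T ⟨(u, v), h.mem⟩) (T ⟨(i, j), hij⟩) * y *
      symmetrizer K (T.subtableau h.le).rowSubgroup = 0 := by
  have hiv : (i, v) ∈ lam.cells := lam.up_left_mem hi.le le_rfl h.mem
  set a := T ⟨(u, v), h.mem⟩ with ha
  set b := T ⟨(i, j), hij⟩ with hb
  set d := T ⟨(i, v), hiv⟩ with hd
  set Y := y * symmetrizer K (T.subtableau h.le).rowSubgroup with hY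
  have hab : a ≠ b := fun heq => by
    have := congrArg (fun c => c.1.1) (T.injective heq)
    simp only at this; omega
  have had : a ≠ d := fun heq => by
    have := congrArg (fun c => c.1.1) (T.injective heq)
    simp only at this; omega
  have hbd : b ≠ d := fun heq => hj (congrArg (fun c => c.1.2) (T.injective heq))
  have hb' : b ∈ (T.subtableau h.le).row i := by
    rw [row_subtableau h]
    exact ⟨⟨⟨(i, j), hij⟩, rfl, rfl⟩, hab.symm⟩
  have hd' : d ∈ (T.subtableau h.le).row i := by
    rw [row_subtableau h]
    exact ⟨⟨⟨(i, v), hiv⟩, rfl, rfl⟩, had.symm⟩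
  have h1 : transp K b d * Y = Y := by
    rw [hY, ← mul_assoc, hy.eq, mul_assoc, transp, of_mul_symmetrizer (swap_mem_rowSubgroup _ hb' hd')]
  have h2 : w * transp K a b * Y = -(w * transp K a b * Y) := by
    have h0 : transp K a b * transp K b d = transp K a d * transp K a b := by
      rw [transp_comm a b, transp_mul_transp_left hbd had]
    calc w * transp K a b * Y = w * transp K a b * (transp K b d * Y) := by rw [h1]
      _ = w * (transp K a b * transp K b d) * Y := by simp only [mul_assoc]
      _ = w * transp K a d * (transp K a b * Y) := by rw [h0]; simp only [mul_assoc]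
      _ = _ := by
        rw [hw.antisymm v a (T.mem_columnEntries.2 ⟨u, h.mem, rfl⟩) d
          (T.mem_columnEntries.2 ⟨i, hiv, rfl⟩) had, neg_mul, mul_assoc]
  have h3 := add_eq_zero_iff_eq_neg.2 h2
  rw [← two_smul K] at h3
  rw [mul_assoc, ← hY]
  exact (smul_eq_zero.1 h3).resolve_left two_ne_zero

/-- The factors of the lower columns are absorbed by the row symmetrizer of `S`. -/
theorem mul_layerProd_mul_symmetrizer (h : IsRemoval lam mu u v)
    (hw : ColumnRelations T.columnEntries w) :
    w * layerProd K (range (lam.rowLen 0)) T.columnEntries #(T.columnEntries v)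
        (T ⟨(u, v), h.mem⟩) 1 * symmetrizer K (T.subtableau h.le).rowSubgroup =
      w * symmetrizer K (T.subtableau h.le).rowSubgroup := by
  have hC := T.isColumnFamily (n := lam.rowLen 0) le_rfl
  have hcv : #(T.columnEntries v) = u + 1 := by rw [card_columnEntries, h.colLen_self]
  have key : ∀ L : List ℕ, L.Nodup → (∀ t ∈ L, t < u + 1) →
      w * (L.map fun t => layerFactor K (range (lam.rowLen 0)) T.columnEntries #(T.columnEntries v)
        (T ⟨(u, v), h.mem⟩) t).prod * symmetrizer K (T.subtableau h.le).rowSubgroup =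
      w * symmetrizer K (T.subtableau h.le).rowSubgroup := by
    intro L
    induction L with
    | nil => simp
    | cons t L ih =>
      intro hL hlt
      rw [List.nodup_cons] at hL
      have ih' := ih hL.2 fun k hk => hlt k (List.mem_cons_of_mem _ hk)
      have ht := hlt t List.mem_cons_self
      rw [List.map_cons, List.prod_cons, layerFactor, ← mul_assoc, mul_sub, mul_one, sub_mul, sub_mul,
        ih', mul_smul_comm, smul_mul_assoc, smul_mul_assoc, mul_starSum, sum_mul, sum_mul,
        sum_eq_zero, smul_zero, sub_zero]
      intro b hb
      obtain ⟨j, hj, hjt⟩ := IsColumnFamily.exists_of_mem_layer hb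
      obtain ⟨i, hij, rfl⟩ := T.mem_columnEntries.1 hj
      rw [card_columnEntries] at hjt
      have hi : i < lam.colLen j := mem_iff_lt_colLen.1 hij
      have hjv : j ≠ v := by rintro rfl; rw [h.colLen_self] at hjt; omega
      have hiu : i < u := by omega
      refine mul_transp_mul_symmetrizer h hw hij hiu hjv ?_
      refine Commute.list_prod_right _ _ fun y hy => ?_
      obtain ⟨k, hk, rfl⟩ := List.mem_map.1 hy
      refine commute_layerFactor (hC.commute_layer hj
        (T.mem_columnEntries.2 ⟨i, lam.up_left_mem hiu.le le_rfl h.mem, rfl⟩) ?_ ?_ ?_)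
      · intro heq
        have := congrArg (fun c => c.1.1) (T.injective heq)
        simp only at this; omega
      · intro heq
        have := congrArg (fun c => c.1.1) (T.injective heq)
        simp only at this; omega
      · rw [hcv, card_columnEntries, hjt]
        have hkt : k ≠ t := by rintro rfl; exact hL.1 hk
        have := hlt k (List.mem_cons_of_mem _ hk)
        omega
  have h0 := key ((List.range (#(T.columnEntries v) - 1)).map fun k => #(T.columnEntries v) - 1 - k)
    (List.Nodup.map_on (fun x hx y hy hxy => by
      rw [List.mem_range] at hx hy; omega) List.nodup_range) (fun t ht => by
      obtain ⟨k, _, rfl⟩ := List.mem_map.1 ht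
      omega)
  rw [List.map_map] at h0
  exact h0

/-- If `a` is the last entry of the last row, the sum over the row of `a` is a scalar in front of the
row symmetrizer of `S`. -/
theorem mul_starSum_row_mul_symmetrizer (h : IsRemoval lam mu u v) (hlast : lam.colLen 0 = u + 1)
    (hw : ColumnRelations T.columnEntries w) :
    w * (1 + starSum K (T ⟨(u, v), h.mem⟩) ((T.rowEntries u).erase (T ⟨(u, v), h.mem⟩))) *
        symmetrizer K (T.subtableau h.le).rowSubgroup =
      (v + 1 : K) • (w * symmetrizer K (T.subtableau h.le).rowSubgroup) := by
  set a := T ⟨(u, v), h.mem⟩ with ha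
  have hmem : ∀ j < v, (u, j) ∈ lam.cells := fun j hj => lam.up_left_mem le_rfl hj.le h.mem
  have hrow : (T.rowEntries u).erase a =
      (range v).attach.image fun j => T ⟨(u, j.1), hmem j.1 (mem_range.1 j.2)⟩ := by
    ext x
    rw [mem_erase, mem_rowEntries, mem_image]
    constructor
    · rintro ⟨hxa, j, hj, rfl⟩
      have h1 : j < lam.rowLen u := mem_iff_lt_rowLen.1 hj
      have hjv : j ≠ v := by rintro rfl; exact hxa rfl
      rw [h.rowLen_self] at h1
      exact ⟨⟨j, mem_range.2 (by omega)⟩, mem_attach _ _, rfl⟩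
    · rintro ⟨⟨j, hj⟩, -, rfl⟩
      rw [mem_range] at hj
      refine ⟨fun heq => ?_, j, hmem j hj, rfl⟩
      have := congrArg (fun c => c.1.2) (T.injective heq)
      simp only at this; omega
  have key : ∀ j, ∀ hj : j < v, w * transp K a (T ⟨(u, j), hmem j hj⟩) *
      symmetrizer K (T.subtableau h.le).rowSubgroup =
        w * symmetrizer K (T.subtableau h.le).rowSubgroup := by
    intro j hj
    have hcol : lam.colLen j = u + 1 := by
      have h1 := lam.colLen_anti 0 j (Nat.zero_le j)
      have h2 := lam.colLen_anti j v hj.le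
      rw [h.colLen_self] at h2
      omega
    have h1 := hw.exchange j v hj.ne (by
      rw [card_columnEntries, card_columnEntries, hcol, h.colLen_self]) a
      (T.mem_columnEntries.2 ⟨u, h.mem, rfl⟩)
    have hmemj : T ⟨(u, j), hmem j hj⟩ ∈ T.columnEntries j :=
      T.mem_columnEntries.2 ⟨u, hmem j hj, rfl⟩
    rw [mul_starSum, ← add_sum_erase _ _ hmemj] at h1
    conv_rhs => rw [← h1]
    rw [add_mul, sum_mul, sum_eq_zero, add_zero]
    intro b hb
    obtain ⟨i, hij, rfl⟩ := T.mem_columnEntries.1 (mem_of_mem_erase hb)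
    have hi : i < lam.colLen j := mem_iff_lt_colLen.1 hij
    have hiu : i ≠ u := by rintro rfl; exact ne_of_mem_erase hb rfl
    have h2 := mul_transp_mul_symmetrizer h hw hij (by omega) hj.ne (Commute.one_right _)
    rwa [mul_one] at h2
  rw [mul_add, mul_one, add_mul, hrow, starSum, sum_image, mul_sum, sum_mul,
    sum_congr rfl fun j _ => key j.1 (mem_range.1 j.2), sum_const, card_attach, card_range,
    ← Nat.cast_smul_eq_nsmul K]
  · module
  · intro x _ y _ hxy
    exact Subtype.ext (congrArg (fun c => c.1.2) (T.injective hxy))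

end YoungTableau

namespace RemovalData

variable {ι : Type*} {s : Finset ι} {C : ι → Finset A} {k : ι} {a : A}
  {w : MonoidAlgebra K (Equiv.Perm A)}

theorem mul_layerProd_mul_one_sub (H : RemovalData s C k a w) {h : ℕ} (hh : h ≤ #(C k)) :
    w * layerProd K s C #(C k) a h * (1 - starSum K a ((C k).erase a)) =
      ∑ d ∈ C k, w * layerProd K s C #(C k) d h := by
  rw [← add_sum_erase _ _ H.mem, mul_sub, mul_one, mul_starSum, sub_eq_add_neg, ← sum_neg_distrib]
  congr 1
  refine sum_congr rfl fun d hd => ?_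
  have hda := ne_of_mem_erase hd
  have hd' := mem_of_mem_erase hd
  rw [mul_assoc, transp_comm, ← transp_mul_layerProd hh fun i _ _ => by
      rw [H.family.mem_layer hd', H.family.mem_layer H.mem],
    ← mul_assoc, H.rel.antisymm k d hd' a H.mem hda, neg_mul, neg_neg]

end RemovalData

variable [Fintype A] [CharZero K]

/-- The Young symmetrizer of `T` acts by the product of the hook lengths on all the elements that
satisfy the column relations of `T`. -/
theorem ColumnRelations.mul_youngSymmetrizer (n : ℕ) (lam : YoungDiagram) (hn : lam.card = n)
    (T : YoungTableau lam A) (w : MonoidAlgebra K (Equiv.Perm A))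
    (hw : ColumnRelations T.columnEntries w) :
    w * T.youngSymmetrizer K = (lam.hookProduct : K) • w := by
  induction n generalizing lam w with
  | zero =>
    have h0 : lam.cells = ∅ := card_eq_zero.1 hn
    have hempty : ∀ c : {c : ℕ × ℕ // c ∈ lam.cells}, False := fun c =>
      notMem_empty _ (subset_of_eq h0 c.2)
    have hrange : ∀ x, x ∉ Set.range T := by rintro x ⟨c, -⟩; exact hempty c
    have h1 : T.rowSubgroup = ⊥ := by
      rw [eq_bot_iff]
      intro σ hσ
      rw [YoungTableau.rowSubgroup_eq, mem_familySubgroup] at hσ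
      exact Subgroup.mem_bot.2 (Equiv.ext fun x => hσ.1 x (hrange x))
    have h2 : T.columnSubgroup = ⊥ := by
      rw [eq_bot_iff]
      intro σ hσ
      rw [YoungTableau.columnSubgroup_eq, mem_familySubgroup] at hσ
      exact Subgroup.mem_bot.2 (Equiv.ext fun x => hσ.1 x (hrange x))
    have h3 : lam.hookProduct = 1 := by rw [hookProduct, h0, prod_empty]
    classical
    rw [YoungTableau.youngSymmetrizer_eq, h1, h2, h3, symmetrizer, antisymmetrizer]
    simp only [Subgroup.mem_bot, sum_filter, sum_ite_eq', mem_univ, if_true, map_one, Units.val_one,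
      Int.cast_one, one_smul, mul_one, Nat.cast_one]
  | succ n ih =>
    obtain ⟨mu, u, v, h, hlast⟩ := exists_isRemoval_last (lam := lam) (by omega)
    have hcard : mu.card = n := by
      have h1 : mu.card = lam.card - 1 := by
        rw [YoungDiagram.card, h.cells_eq, card_erase_of_mem h.mem]
      omega
    have H := YoungTableau.removalData h hw
    have hcv : #(T.columnEntries v) = u + 1 := by rw [T.card_columnEntries, h.colLen_self]
    set a := T ⟨(u, v), h.mem⟩ with ha
    have hrel := H.columnRelations
    rw [← YoungTableau.columnEntries_subtableau h] at hrel
    have hmu := ih mu hcard (T.subtableau h.le) _ hrel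
    rw [YoungTableau.youngSymmetrizer_eq, ← mul_assoc,
      YoungTableau.mul_layerProd_mul_symmetrizer h hw] at hmu
    have hpos : 1 ≤ #(T.columnEntries v) := by omega
    have hsum := H.mul_layerProd_mul_one_sub hpos
    have hdist : ∏ i ∈ Ico 1 (u + 1),
        ((axialDist K (range (lam.rowLen 0)) T.columnEntries (u + 1) i + 1) /
          axialDist K (range (lam.rowLen 0)) T.columnEntries (u + 1) i) =
        ∏ i ∈ range u, ((mu.hookLength (i, v) : K) + 1) / mu.hookLength (i, v) := by
      rw [prod_Ico_eq_prod_range]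
      refine prod_congr rfl fun i hi => ?_
      rw [add_comm 1 i, T.axialDist_columnEntries le_rfl h (mem_range.1 hi)]
    rw [hw.sum_mul_layerProd H.family hpos, Nat.cast_one, layerWeight_mul hpos, hcv, hdist,
      ← hcv] at hsum
    -- No cell is below the last row, so that its hooks in `mu` have lengths `v, ..., 1`.
    have hprod : ∏ j ∈ range v, ((mu.hookLength (u, j) : K) + 1) / mu.hookLength (u, j) = v + 1 := by
      have h1 : ∀ j ∈ range v, ((mu.hookLength (u, j) : K) + 1) / mu.hookLength (u, j) =
          ((v - j : ℕ) + 1) / (v - j : ℕ) := by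
        intro j hj
        rw [mem_range] at hj
        have hmem : (u, j) ∈ mu.cells := h.mem_iff.2
          ⟨by simp; omega, lam.up_left_mem le_rfl hj.le h.mem⟩
        have h2 := hookLength_add hmem
        have h3 := h.rowLen_add u
        have h4 := h.colLen_add j
        rw [if_pos rfl, h.rowLen_self] at h3
        rw [if_neg hj.ne] at h4
        have h5 := lam.colLen_anti 0 j (Nat.zero_le j)
        have h6 := lam.colLen_anti j v hj.le
        rw [h.colLen_self] at h6
        rw [show mu.hookLength (u, j) = v - j by omega]
      rw [prod_congr rfl h1]
      clear * -
      induction v with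
      | zero => simp
      | succ v ih =>
        rw [prod_range_succ', prod_congr rfl fun j hj => by rw [Nat.succ_sub_succ], ih]
        push_cast
        have : (v + 1 : K) ≠ 0 := by exact_mod_cast Nat.succ_ne_zero v
        field_simp
    rw [YoungTableau.youngSymmetrizer_eq, YoungTableau.symmetrizer_rowSubgroup h,
      YoungTableau.antisymmetrizer_columnSubgroup h, ← mul_assoc, ← mul_assoc, ← mul_assoc,
      YoungTableau.mul_starSum_row_mul_symmetrizer h hlast hw, smul_mul_assoc, hmu, smul_mul_assoc,
      smul_mul_assoc, hsum, h.hookProduct_eq K, hprod, smul_smul, smul_smul]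
    congr 1
    ring

end Main

/-! ### Blocks -/

namespace YoungDiagram

variable {ν : YoungDiagram} {w i j : ℕ}

theorem mem_dropColumns : (i, j) ∈ ν.dropColumns w ↔ (i, j + w) ∈ ν := by
  refine ⟨fun h => mem_of_mem_dropColumns h, fun h => ?_⟩
  rw [← mem_cells, dropColumns, mem_image]
  exact ⟨(i, j + w), mem_filter.2 ⟨h, by simp⟩, by simp⟩

theorem rowLen_dropColumns : (ν.dropColumns w).rowLen i = ν.rowLen i - w := by
  refine eq_of_forall_lt_iff fun j => ?_
  rw [← mem_iff_lt_rowLen, mem_dropColumns, mem_iff_lt_rowLen]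
  omega

theorem colLen_dropColumns : (ν.dropColumns w).colLen j = ν.colLen (j + w) := by
  refine eq_of_forall_lt_iff fun i => ?_
  rw [← mem_iff_lt_colLen, mem_dropColumns, mem_iff_lt_colLen]

theorem mem_columnHeights {h : ℕ} : h ∈ ν.columnHeights ↔ 0 < h ∧ ∃ j, ν.colLen j = h := by
  simp only [columnHeights, mem_image, mem_range, ← mem_iff_lt_rowLen, mem_iff_lt_colLen]
  constructor
  · rintro ⟨j, hj, rfl⟩; exact ⟨hj, j, rfl⟩
  · rintro ⟨hj, j, rfl⟩; exact ⟨j, hj, rfl⟩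

theorem blockHeight_mem (i : Fin ν.numBlocks) : ν.blockHeight i ∈ ν.columnHeights :=
  orderEmbOfFin_mem _ _ _

theorem exists_blockHeight_eq {h : ℕ} (hh : h ∈ ν.columnHeights) :
    ∃ i : Fin ν.numBlocks, ν.blockHeight i = h := by
  have h1 : h ∈ Set.range (ν.columnHeights.orderEmbOfFin rfl) := by
    rw [range_orderEmbOfFin]; exact hh
  obtain ⟨i, rfl⟩ := h1
  exact ⟨Fin.rev i, congrArg (ν.columnHeights.orderEmbOfFin rfl) (Fin.rev_rev i)⟩

theorem blockHeight_strictAnti : StrictAnti ν.blockHeight := fun _ _ hij =>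
  (ν.columnHeights.orderEmbOfFin rfl).strictMono (Fin.rev_lt_rev.2 hij)

/-- The first blocks consist of the columns which meet the last row of the last one of them. -/
theorem sum_blockLength (i : Fin ν.numBlocks) :
    ∑ j ∈ Iic i, ν.blockLength j = ν.rowLen (ν.blockHeight i - 1) := by
  have hpos := (mem_columnHeights.1 (ν.blockHeight_mem i)).1
  rw [← card_filter_colLen le_rfl, Nat.sub_add_cancel hpos]
  simp_rw [blockLength]
  rw [← card_biUnion]
  · congr 1
    ext c
    simp only [mem_biUnion, mem_Iic, mem_filter, mem_range]
    constructor
    · rintro ⟨j, hj, hc, hcj⟩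
      exact ⟨hc, hcj ▸ blockHeight_strictAnti.antitone hj⟩
    · rintro ⟨hc, hci⟩
      obtain ⟨j, hj⟩ := exists_blockHeight_eq (mem_columnHeights.2 ⟨hpos.trans_le hci, c, rfl⟩)
      refine ⟨j, ?_, hc, hj.symm⟩
      rw [← hj] at hci
      exact blockHeight_strictAnti.le_iff_ge.1 hci
  · intro j _ k _ hjk
    refine disjoint_filter.2 fun c _ h1 h2 => hjk ?_
    exact blockHeight_strictAnti.injective (h1.symm.trans h2)

theorem prod_filter_of_eq_one {M : Type*} [Monoid M] (f : ℕ → M) (s : Finset ℕ) (L : List ℕ)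
    (hf : ∀ h ∈ L, h ∉ s → f h = 1) : ((L.filter (· ∈ s)).map f).prod = (L.map f).prod := by
  induction L with
  | nil => rfl
  | cons x L ih =>
    have ih' := ih fun h hh => hf h (List.mem_cons_of_mem _ hh)
    by_cases hx : x ∈ s
    · simp [hx, ih']
    · simp [hx, ih', hf x List.mem_cons_self hx]

/-- A product over the blocks as a product over all the heights, in decreasing order. -/
theorem prod_ofFn_blockHeight {M : Type*} [Monoid M] (f : ℕ → M) (u : ℕ)
    (hle : ∀ h ∈ ν.columnHeights, h ≤ u)
    (hf : ∀ h, 1 ≤ h → h ≤ u → h ∉ ν.columnHeights → f h = 1) :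
    (List.ofFn fun i : Fin ν.numBlocks => f (ν.blockHeight i)).prod =
      ((List.range u).map fun k => f (u - k)).prod := by
  have h1 : (List.ofFn fun i : Fin ν.numBlocks => f (ν.blockHeight i)) =
      (List.ofFn ν.blockHeight).map f := by rw [List.map_ofFn]; rfl
  have h2 : ((List.range u).map fun k => f (u - k)) = ((List.range u).map fun k => u - k).map f := by
    rw [List.map_map]; rfl
  have h3 : List.ofFn ν.blockHeight =
      ((List.range u).map fun k => u - k).filter (· ∈ ν.columnHeights) := by
    have hs1 : (List.ofFn ν.blockHeight).Pairwise (· > ·) :=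
      List.pairwise_ofFn.2 fun i j hij => blockHeight_strictAnti hij
    have hs2 : (((List.range u).map fun k => u - k).filter (· ∈ ν.columnHeights)).Pairwise
        (· > ·) := by
      refine List.Pairwise.filter _ ?_
      rw [List.pairwise_map]
      refine List.Pairwise.imp_of_mem ?_ (List.pairwise_lt_range (n := u))
      intro a b ha hb hab
      rw [List.mem_range] at ha hb
      omega
    refine hs1.eq_of_mem_iff hs2 fun h => ?_
    rw [List.mem_ofFn', List.mem_filter, List.mem_map, decide_eq_true_iff]
    constructor
    · rintro ⟨i, rfl⟩
      have hm := ν.blockHeight_mem i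
      have h4 := hle _ hm
      have h5 := (mem_columnHeights.1 hm).1
      exact ⟨⟨u - ν.blockHeight i, List.mem_range.2 (by omega), by omega⟩, hm⟩
    · exact fun h => exists_blockHeight_eq h.2
  rw [h1, h2, h3, prod_filter_of_eq_one]
  intro h hh
  obtain ⟨k, hk, rfl⟩ := List.mem_map.1 hh
  rw [List.mem_range] at hk
  exact hf _ (by omega) (by omega)

variable {lam mu : YoungDiagram} {u v : ℕ}

theorem IsRemoval.colLen_of_lt (h : IsRemoval lam mu u v) (hj : v < j) :
    lam.colLen j ≤ u ∧ mu.colLen j = lam.colLen j := by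
  have h1 := h.colLen_add j
  rw [if_neg hj.ne'] at h1
  refine ⟨?_, h1⟩
  by_contra! hlt
  have h2 : j < lam.rowLen u := mem_iff_lt_rowLen.1 (mem_iff_lt_colLen.2 hlt)
  rw [h.rowLen_self] at h2
  omega

theorem IsRemoval.lt_of_colLen_le (h : IsRemoval lam mu u v) (hj : lam.colLen j ≤ u) : v < j := by
  by_contra! hle
  have := lam.colLen_anti j v hle
  rw [h.colLen_self] at this
  omega

theorem IsRemoval.le_of_mem_columnHeights (h : IsRemoval lam mu u v) {x : ℕ}
    (hx : x ∈ (mu.dropColumns (v + 1)).columnHeights) : x ≤ u := by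
  obtain ⟨-, j, rfl⟩ := mem_columnHeights.1 hx
  rw [colLen_dropColumns, (h.colLen_of_lt (by omega)).2]
  exact (h.colLen_of_lt (by omega)).1

end YoungDiagram

namespace YoungTableau

open YoungDiagram

variable {A : Type*} [DecidableEq A] {lam mu : YoungDiagram} {u v : ℕ} {T : YoungTableau lam A}

theorem block_dropColumns (h : IsRemoval lam mu u v)
    (i : Fin (mu.dropColumns (v + 1)).numBlocks) :
    ((T.subtableau h.le).dropColumns (v + 1)).block i =
      layer (range (lam.rowLen 0)) T.columnEntries ((mu.dropColumns (v + 1)).blockHeight i) := by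
  ext x
  simp only [block, mem_image, mem_filter, mem_univ, true_and]
  constructor
  · rintro ⟨⟨⟨p, q⟩, hc⟩, hq, rfl⟩
    have hmem : (p, q + (v + 1)) ∈ lam.cells := h.le (mem_of_mem_dropColumns hc)
    have hx : T ⟨(p, q + (v + 1)), hmem⟩ ∈ T.columnEntries (q + (v + 1)) :=
      T.mem_columnEntries.2 ⟨p, hmem, rfl⟩
    refine ((T.isColumnFamily le_rfl).mem_layer hx).2 ?_
    rw [card_columnEntries, ← hq, colLen_dropColumns, (h.colLen_of_lt (by omega)).2]
  · intro hx
    obtain ⟨j, hj, hjh⟩ := IsColumnFamily.exists_of_mem_layer hx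
    obtain ⟨p, hp, rfl⟩ := T.mem_columnEntries.1 hj
    rw [card_columnEntries] at hjh
    have hv : v < j := h.lt_of_colLen_le (hjh ▸ h.le_of_mem_columnHeights (blockHeight_mem i))
    obtain ⟨q, rfl⟩ := Nat.exists_eq_add_of_lt hv
    have hjq : v + q + 1 = q + (v + 1) := by omega
    have hmu : (p, q + (v + 1)) ∈ mu := by
      rw [h.mem_iff, ← hjq]
      exact ⟨by simp; omega, hp⟩
    refine ⟨⟨(p, q), mem_dropColumns.2 hmu⟩, ?_, ?_⟩
    · rw [colLen_dropColumns, (h.colLen_of_lt (by omega)).2, ← hjq, hjh]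
    · change T ⟨(p, q + (v + 1)), _⟩ = T ⟨(p, v + q + 1), hp⟩
      congr 2
      rw [hjq]

variable {K : Type*} [Field K] [Fintype A]

theorem prod_blocks_eq_layerProd (h : IsRemoval lam mu u v) :
    (List.ofFn fun i : Fin (mu.dropColumns (v + 1)).numBlocks =>
        1 - ((mu.hookLength ((mu.dropColumns (v + 1)).blockHeight i - 1, v) : K)⁻¹ •
          ((T.subtableau h.le).dropColumns (v + 1)).blockSum K (T ⟨(u, v), h.mem⟩) i)).prod =
      layerProd K (range (lam.rowLen 0)) T.columnEntries #(T.columnEntries v)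
        (T ⟨(u, v), h.mem⟩) 1 := by
  rw [card_columnEntries, h.colLen_self, layerProd, Nat.add_sub_cancel,
    ← prod_ofFn_blockHeight (ν := mu.dropColumns (v + 1))
      (layerFactor K (range (lam.rowLen 0)) T.columnEntries (u + 1) (T ⟨(u, v), h.mem⟩)) u
      (fun _ => h.le_of_mem_columnHeights) fun x hx1 hxu hx => ?_]
  · congr 2
    funext i
    have h1 := mem_columnHeights.1 (blockHeight_mem i)
    have h2 := h.le_of_mem_columnHeights (blockHeight_mem i)
    rw [layerFactor, blockSum, block_dropColumns h, ← T.axialDist_columnEntries le_rfl h (by omega),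
      Nat.sub_add_cancel h1.1]
    rfl
  · have hempty : layer (range (lam.rowLen 0)) T.columnEntries x = ∅ := by
      rw [eq_empty_iff_forall_notMem]
      intro y hy
      obtain ⟨j, -, hj⟩ := IsColumnFamily.exists_of_mem_layer hy
      rw [card_columnEntries] at hj
      have hv : v < j := h.lt_of_colLen_le (by omega)
      refine hx (mem_columnHeights.2 ⟨hx1, j - (v + 1), ?_⟩)
      rw [colLen_dropColumns, Nat.sub_add_cancel hv, (h.colLen_of_lt hv).2, hj]
    rw [layerFactor, hempty, starSum, sum_empty, smul_zero, sub_zero]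

variable [CharZero K]

theorem youngSymmetrizer_mul_youngSymmetrizer (h : IsRemoval lam mu u v) :
    T.youngSymmetrizer K * (T.subtableau h.le).youngSymmetrizer K =
      (mu.hookProduct : K) • (T.youngSymmetrizer K *
        layerProd K (range (lam.rowLen 0)) T.columnEntries #(T.columnEntries v)
          (T ⟨(u, v), h.mem⟩) 1) := by
  have hw := T.columnRelations_youngSymmetrizer (K := K)
  have hrel := (removalData h hw).columnRelations
  rw [← columnEntries_subtableau h] at hrel
  rw [← ColumnRelations.mul_youngSymmetrizer _ mu rfl (T.subtableau h.le) _ hrel,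
    (T.subtableau h.le).youngSymmetrizer_eq, ← mul_assoc, ← mul_assoc,
    mul_layerProd_mul_symmetrizer h hw]

end YoungTableau

end YoungSymmetrizerProducts

/-- `(u, v)` is the cell, indexed from `0`, of the entry `a` of `T` outside `S`; in the 1-based
convention its position is `(u + 1, v + 1)`, so that `v + 1` columns of `S` are removed, and the box in
position `(h, v + 1)` is the cell `(h - 1, v)`. The first two conjuncts describe the shape of the
truncated tableau, the third one the hook lengths, and the last one is the product formula, in which the
factors are multiplied in the order of the blocks, from left to right. -/
theorem theorem2 {K : Type*} [Field K] [CharZero K] (k n : ℕ) (hn : n = k + 1)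
    (lam mu : YoungDiagram) (hlam : lam.card = n) (hmu : mu.card = k) (hsub : mu ≤ lam)
    (T : YoungTableau lam (Fin n)) (hT : Function.Bijective T)
    (S : YoungTableau mu (Fin n)) (hS : S = T.subtableau hsub)
    (u v : ℕ) (huv : (u, v) ∈ lam.cells) (huv' : (u, v) ∉ mu.cells)
    (a : Fin n) (ha : a = T ⟨(u, v), huv⟩) :
    (∀ i < u, (mu.dropColumns (v + 1)).rowLen i + (v + 1) = mu.rowLen i) ∧
    (∀ i, u ≤ i → (mu.dropColumns (v + 1)).rowLen i = 0) ∧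
    (∀ i : Fin (mu.dropColumns (v + 1)).numBlocks,
      mu.hookLength ((mu.dropColumns (v + 1)).blockHeight i - 1, v) +
          (mu.dropColumns (v + 1)).blockHeight i =
        ∑ j ∈ Finset.Iic i, (mu.dropColumns (v + 1)).blockLength j + (u + 1)) ∧
    T.youngSymmetrizer K * S.youngSymmetrizer K =
      T.youngSymmetrizer K * (mu.hookProduct : MonoidAlgebra K (Equiv.Perm (Fin n))) *
        (List.ofFn fun i : Fin (mu.dropColumns (v + 1)).numBlocks =>
          1 - ((mu.hookLength ((mu.dropColumns (v + 1)).blockHeight i - 1, v) : K)⁻¹ •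
            (S.dropColumns (v + 1)).blockSum K a i)).prod := by
  subst hS ha
  have h : YoungDiagram.IsRemoval lam mu u v := by
    refine ⟨huv, Finset.eq_of_subset_of_card_le (fun c hc => Finset.mem_erase.2 ⟨?_, hsub hc⟩) ?_⟩
    · rintro rfl; exact huv' hc
    · rw [Finset.card_erase_of_mem huv]
      change lam.card - 1 ≤ mu.card
      omega
  have hrow : ∀ i < u, (mu.dropColumns (v + 1)).rowLen i + (v + 1) = mu.rowLen i := by
    intro i hi
    have h1 := h.rowLen_add i
    have h2 := lam.rowLen_anti i u hi.le
    rw [h.rowLen_self] at h2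
    rw [if_neg hi.ne] at h1
    rw [YoungDiagram.rowLen_dropColumns]
    omega
  refine ⟨hrow, fun i hi => ?_, fun i => ?_, ?_⟩
  · have h1 := h.rowLen_add u
    have h2 := mu.rowLen_anti u i hi
    rw [h.rowLen_self, if_pos rfl] at h1
    rw [YoungDiagram.rowLen_dropColumns]
    omega
  · have h1 := (YoungDiagram.mem_columnHeights.1 (YoungDiagram.blockHeight_mem i)).1
    have h2 := h.le_of_mem_columnHeights (YoungDiagram.blockHeight_mem i)
    rw [YoungDiagram.sum_blockLength]
    set x := (mu.dropColumns (v + 1)).blockHeight i with hx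
    have hmem : (x - 1, v) ∈ mu.cells :=
      h.mem_iff.2 ⟨by simp; omega, lam.up_left_mem (by omega) le_rfl huv⟩
    have h3 := YoungDiagram.hookLength_add hmem
    have h4 := hrow (x - 1) (by omega)
    have h5 := h.colLen_add v
    rw [h.colLen_self, if_pos rfl] at h5
    omega
  · rw [YoungTableau.prod_blocks_eq_layerProd h, YoungTableau.youngSymmetrizer_mul_youngSymmetrizer h,
      Nat.cast_smul_eq_nsmul, nsmul_eq_mul, ← mul_assoc, Nat.cast_comm]
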